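/- Let $\Omega=(-1,1)\times(0,1)\subset\mathbb R^2$ and $|x|_\infty=\max\{|x_1|,|x_2|\}$. Define \[ u_1(x)=\frac{|x|_\infty+3}{4|x|_\infty}\,x,\qquad u_2(x)=\begin{cases}(x_1,\,1-(1-x_2)(7-8|x_1|)) & |x_1|<\frac34,\\ x & |x_1|\ge\frac34,\end{cases} \] \[ u_3(x)=\begin{cases} \big(\tfrac12(\operatorname{sign}x_1\,(1-4(1-|x_1|)(1-x_2))+3),\,2x_2-1\big) & 0\le x_2<\frac34,\ \frac34<|x_1|,\\ \big(\tfrac{4x_1x_2}{4x_2+3}+\tfrac32,\,2x_2-1\big) & |x_1|<\frac{4x_2+3}8,\ 0\le x_2<\frac34,\\ \big(\tfrac{-4x_1x_2}{4x_2+3}+\tfrac32,\,2x_2-1\big) & |x_1|<\frac{4x_2+3}8,\ -\frac14\le x_2<0,\\ \big(\tfrac{x_1+3}2,\,2x_2-1\big) & \text{elsewhere}, \end{cases} \] and, for $\frac{4\pi}5<\alpha<\pi$, $u_4(r,\theta)=(r\cos(\alpha\theta),\,r\sin(\alpha\theta))$ (that is, Cartesian coordinates are read as polar coordinates $(r,\theta)$).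 Let $u=u_4\circ u_3\circ u_2\circ u_1$ on $\Omega$. For $p\ge1$, let $\mathcal A_p(\Omega)$ be the class of maps $u\in W^{1,p}(\Omega;\mathbb R^2)$ with $\det Du\in L^1(\Omega)$ such that \[ \int_\Omega\big([\operatorname{adj}Du\;g(u)]\cdot D\phi+\det Du\;\phi\,\operatorname{div}g(u)\big)\,dx=0 \qquad\forall\,\phi\in C^1_c(\Omega),\ g\in C^1_c(\mathbb R^2;\mathbb R^2), \] and let $\overline{\mathcal A}_p(\Omega)$ be the class of maps $u\in W^{1,p}(\Omega;\mathbb R^2)$ whose trace $u_{|\partial\Omega}$ lies in $W^{1,p}(\partial\Omega;\mathbb R^2)$, with $\det Du\in L^1(\Omega)$ and such that, $D^\tau u$ denoting the derivative of the trace along $\partial\Omega$ and $n$ the unit exterior normal, \[ \int_\Omega\big([\operatorname{adj}Du\;g(u)]\cdot D\phi+\det Du\;\phi\,\operatorname{div}g(u)\big)\,dx=\int_{\partial\Omega}\phi\,(\operatorname{adj}D^\tau u\;g(u))\cdot n\,d\mathcal H^1 \qquad\forall\,\phi\in C^1(\overline\Omega),\ g\in C^1_c(\mathbb R^2;\mathbb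 R^2). \] Then, for every $\alpha\in(\frac{4\pi}5,\pi)$: (i) $u\in\mathcal A_p(\Omega)$ and $u\notin\overline{\mathcal A}_p(\Omega)$ for every $1\le p<2$; (ii) $\det Du>0$ a.e. in $\Omega$; (iii) the trace of $u$ on $\partial\Omega$ coincides with the restriction to $\partial\Omega$ of a $C^\infty$ diffeomorphism $u_0$ between an open neighbourhood of $\overline\Omega$ and an open subset of $\mathbb R^2$; (iv) $u$ is approximately invertible on the boundary (AIB): its trace is continuous on $\partial\Omega$ and is a uniform limit on $\partial\Omega$ of continuous injective maps $\partial\Omega\to\mathbb R^2$; (v) $u$ is not injective a.e.: there is no $\widetilde\Omega\subset\Omega$ with $\mathcal L^2(\Omega\setminus\widetilde\Omega)=0$ on which $u$ is injective. Hence a map in $\mathcal A_p(\Omega)\cap\mathrm{AIB}$ with $\det Du>0$ a.e. need not be injective a.e.: the divergence identities up to the boundary cannot be replaced by those in the interior. -/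

import Mathlib

open MeasureTheory Filter Topology Matrix
open scoped MeasureTheory ContDiff

noncomputable section

/-- The Euclidean plane. -/
abbrev Plane : Type := EuclideanSpace ℝ (Fin 2)

/-- The partial derivative `∂φ/∂x_j` of a scalar function on the plane. -/
def pderiv (j : Fin 2) (φ : Plane → ℝ) (x : Plane) : ℝ :=
  fderiv ℝ φ x (EuclideanSpace.single j 1)

/-- The divergence of a vector field on the plane. -/
def divergence (g : Plane → Plane) (y : Plane) : ℝ :=
  ∑ i : Fin 2, pderiv i (fun z => g z i) y

/-! ### Sobolev maps on a planar open set -/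

/-- `Du` is the distributional gradient in `Ω` of the locally integrable map `u`
(`Du x i j` is `∂u_i/∂x_j`). -/
def IsWeakGradient (Ω : Set Plane) (u : Plane → Plane)
    (Du : Plane → Matrix (Fin 2) (Fin 2) ℝ) : Prop :=
  LocallyIntegrableOn u Ω volume ∧
  (∀ i j, LocallyIntegrableOn (fun x => Du x i j) Ω volume) ∧
  ∀ φ : Plane → ℝ, ContDiff ℝ ∞ φ → HasCompactSupport φ → tsupport φ ⊆ Ω →
    ∀ i j, ∫ x in Ω, u x i * pderiv j φ x = - ∫ x in Ω, Du x i j * φ x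

/-- `u ∈ W^{1,p}(Ω; ℝ²)` with distributional gradient `Du`. -/
def IsSobolev (Ω : Set Plane) (p : ENNReal) (u : Plane → Plane)
    (Du : Plane → Matrix (Fin 2) (Fin 2) ℝ) : Prop :=
  IsWeakGradient Ω u Du ∧
  MemLp u p (volume.restrict Ω) ∧
  ∀ i j, MemLp (fun x => Du x i j) p (volume.restrict Ω)

/-! ### The boundary of a planar domain -/

/-- Arc length (one-dimensional Hausdorff measure) on the boundary of `Ω`. -/
def boundaryMeasure (Ω : Set Plane) : Measure Plane :=
  (μH[1] : Measure Plane).restrict (frontier Ω)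

/-- `ν` is the unit exterior normal of `Ω` at the boundary point `x`: near `x`, every cone around
`-ν` that is strictly smaller than a half plane lies in `Ω`, and every such cone around `ν` lies
outside `Ω`. -/
def IsOuterNormal (Ω : Set Plane) (x ν : Plane) : Prop :=
  x ∈ frontier Ω ∧ ‖ν‖ = 1 ∧
  ∀ ε : ℝ, 0 < ε → ∀ᶠ y in 𝓝 x,
    (inner ℝ (y - x) ν < -(ε * ‖y - x‖) → y ∈ Ω) ∧
    (ε * ‖y - x‖ < inner ℝ (y - x) ν → y ∉ Ω)

open Classical in
/-- The unit exterior normal. For a Lipschitz domain it exists at almost every boundary point;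
at the other points (such as the corners of a rectangle) the value is `0`. -/
def outerNormal (Ω : Set Plane) (x : Plane) : Plane :=
  if h : ∃ ν, IsOuterNormal Ω x ν then h.choose else 0

/-- The unit tangent: the exterior normal turned counterclockwise by a right angle. -/
def unitTangent (Ω : Set Plane) (x : Plane) : Plane :=
  !₂[-(outerNormal Ω x 1), outerNormal Ω x 0]

/-- `w` is the trace on `∂Ω` of the map `u ∈ W^{1,1}(Ω; ℝ²)`: it is the integrable map on `∂Ω` for
which Green's formula holds. -/
def IsTrace (Ω : Set Plane) (u w : Plane → Plane) : Prop :=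
  ∃ Du, IsSobolev Ω 1 u Du ∧ Integrable w (boundaryMeasure Ω) ∧
  ∀ φ : Plane → ℝ, ContDiff ℝ 1 φ → HasCompactSupport φ → ∀ i j,
    ∫ x in Ω, (u x i * pderiv j φ x + Du x i j * φ x) =
      ∫ x, w x i * φ x * outerNormal Ω x j ∂(boundaryMeasure Ω)

/-- `v` is the weak derivative of `w` along the boundary of `Ω`, with respect to arc length and in
the direction of `unitTangent Ω`. -/
def IsWeakTangentialDeriv (Ω : Set Plane) (w v : Plane → Plane) : Prop :=
  Integrable w (boundaryMeasure Ω) ∧ Integrable v (boundaryMeasure Ω) ∧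
  ∀ φ : Plane → ℝ, ContDiff ℝ 1 φ → HasCompactSupport φ → ∀ i,
    ∫ x, w x i * fderiv ℝ φ x (unitTangent Ω x) ∂(boundaryMeasure Ω) =
      - ∫ x, v x i * φ x ∂(boundaryMeasure Ω)

/-- The tangential gradient `D^τ w` as a matrix: it maps the unit tangent to the derivative `v` of
`w` along the boundary, and the normal to `0`. -/
def tangentialGradient (Ω : Set Plane) (v : Plane → Plane) (x : Plane) :
    Matrix (Fin 2) (Fin 2) ℝ :=
  Matrix.vecMulVec (v x).ofLp (unitTangent Ω x).ofLp

/-- `w ∈ W^{1,p}(∂Ω; ℝ²)`, with derivative `v` along the boundary. -/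
def IsBoundarySobolev (Ω : Set Plane) (p : ENNReal) (w v : Plane → Plane) : Prop :=
  IsWeakTangentialDeriv Ω w v ∧
  MemLp w p (boundaryMeasure Ω) ∧ MemLp v p (boundaryMeasure Ω)

/-! ### The divergence identities and the classes of maps -/

/-- `∫_Ω ([adj Du g(u)] · Dφ + det Du φ div g(u)) dx`. -/
def divergenceFunctional (Ω : Set Plane) (u : Plane → Plane)
    (Du : Plane → Matrix (Fin 2) (Fin 2) ℝ) (φ : Plane → ℝ) (g : Plane → Plane) : ℝ :=
  ∫ x in Ω, ((∑ i, ((Du x).adjugate *ᵥ (g (u x)).ofLp) i * pderiv i φ x) +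
    (Du x).det * φ x * divergence g (u x))

/-- `∫_{∂Ω} φ (adj D^τ w g(w)) · n dH¹`, where `v` is the derivative of `w` along `∂Ω`. -/
def boundaryFunctional (Ω : Set Plane) (w v : Plane → Plane) (φ : Plane → ℝ)
    (g : Plane → Plane) : ℝ :=
  ∫ x, φ x * ∑ i, ((tangentialGradient Ω v x).adjugate *ᵥ (g (w x)).ofLp) i * outerNormal Ω x i
    ∂(boundaryMeasure Ω)

/-- The class `A_p(Ω)`: Sobolev maps with integrable Jacobian that satisfy the divergence
identities in `Ω`. -/
def ClassA (Ω : Set Plane) (p : ENNReal) : Set (Plane → Plane) :=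
  {u | ∃ Du, IsSobolev Ω p u Du ∧ IntegrableOn (fun x => (Du x).det) Ω ∧
    ∀ (φ : Plane → ℝ) (g : Plane → Plane),
      ContDiff ℝ 1 φ → HasCompactSupport φ → tsupport φ ⊆ Ω →
      ContDiff ℝ 1 g → HasCompactSupport g →
      divergenceFunctional Ω u Du φ g = 0}

/-- The class `Ā_p(Ω)`, for a bounded Lipschitz domain `Ω`: Sobolev maps with integrable Jacobian
whose trace is Sobolev on `∂Ω`, and that satisfy the divergence identities in the closure of `Ω`.
The functions in `C¹(closure Ω)` are the restrictions of `C¹` functions of the plane. -/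
def ClassABar (Ω : Set Plane) (p : ENNReal) : Set (Plane → Plane) :=
  {u | ∃ Du w v, IsSobolev Ω p u Du ∧ IsTrace Ω u w ∧ IsBoundarySobolev Ω p w v ∧
    IntegrableOn (fun x => (Du x).det) Ω ∧
    ∀ (φ : Plane → ℝ) (g : Plane → Plane),
      ContDiff ℝ 1 φ → ContDiff ℝ 1 g → HasCompactSupport g →
      divergenceFunctional Ω u Du φ g = boundaryFunctional Ω w v φ g}

/-! ### Invertibility -/

/-- The continuous map `w` on `∂Ω` is approximately invertible on the boundary: it is a uniform
limit on `∂Ω` of continuous injective maps. -/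
def ApproxInvertibleOnBoundary (Ω : Set Plane) (w : Plane → Plane) : Prop :=
  ContinuousOn w (frontier Ω) ∧
  ∃ ψ : ℕ → Plane → Plane,
    (∀ k, ContinuousOn (ψ k) (frontier Ω) ∧ Set.InjOn (ψ k) (frontier Ω)) ∧
    TendstoUniformlyOn ψ w atTop (frontier Ω)

/-- A Sobolev map is AIB if (the continuous representative of) its trace is approximately
invertible on the boundary. -/
def IsAIB (Ω : Set Plane) (u : Plane → Plane) : Prop :=
  ∃ w, IsTrace Ω u w ∧ ApproxInvertibleOnBoundary Ω w

/-- `u` is injective a.e. in `Ω`: it is injective on a subset of full measure. -/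
def InjectiveAE (Ω : Set Plane) (u : Plane → Plane) : Prop :=
  ∃ Ω' : Set Plane, Ω' ⊆ Ω ∧ volume (Ω \ Ω') = 0 ∧ Set.InjOn u Ω'

/-! ### The explicit map -/

/-- The rectangle `(-1,1) × (0,1)`. -/
def rect : Set Plane := {x | -1 < x 0 ∧ x 0 < 1 ∧ 0 < x 1 ∧ x 1 < 1}

/-- The max-norm of a vector of the plane. -/
def maxNorm (x : Plane) : ℝ := max |x 0| |x 1|

/-- Opens a cavity at the boundary point `0` of the rectangle. -/
def mapU1 (x : Plane) : Plane := ((maxNorm x + 3) / (4 * maxNorm x)) • x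

/-- Stretches the material above the cavity downwards. -/
def mapU2 (x : Plane) : Plane :=
  if |x 0| < 3 / 4 then !₂[x 0, 1 - (1 - x 1) * (7 - 8 * |x 0|)] else x

/-- Closes the cavity, leaving part of the material outside, and rescales. -/
def mapU3 (x : Plane) : Plane :=
  if (0 ≤ x 1 ∧ x 1 < 3 / 4) ∧ 3 / 4 < |x 0| then
    !₂[1 / 2 * (Real.sign (x 0) * (1 - 4 * (1 - |x 0|) * (1 - x 1)) + 3), 2 * x 1 - 1]
  else if |x 0| < (4 * x 1 + 3) / 8 ∧ (0 ≤ x 1 ∧ x 1 < 3 / 4) then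
    !₂[4 * x 0 * x 1 / (4 * x 1 + 3) + 3 / 2, 2 * x 1 - 1]
  else if |x 0| < (4 * x 1 + 3) / 8 ∧ (-(1 / 4) ≤ x 1 ∧ x 1 < 0) then
    !₂[-4 * x 0 * x 1 / (4 * x 1 + 3) + 3 / 2, 2 * x 1 - 1]
  else !₂[(x 0 + 3) / 2, 2 * x 1 - 1]

/-- `(r, θ) ↦ (r cos (α θ), r sin (α θ))`: revolves the right half plane around the origin, the
Cartesian coordinates of a point being read as polar coordinates `(r, θ)`. -/
def mapU4 (α : ℝ) (x : Plane) : Plane :=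
  !₂[x 0 * Real.cos (α * x 1), x 0 * Real.sin (α * x 1)]

/-- The composite deformation of the rectangle. -/
def leakMap (α : ℝ) : Plane → Plane := mapU4 α ∘ mapU3 ∘ mapU2 ∘ mapU1

end

/-!
The map opens a cavity at the boundary point `0`, lets a tongue of the material through it, and
closes it again. On the boundary nothing of this is visible: there `leakMap α` agrees with
`bendMap α`, which bends the rectangle into an annular sector and is nothing but polar coordinates
(`leakMap_eq_bendMap`). So `bendMap α` is the trace and the boundary diffeomorphism, and since it is
injective, approximate invertibility on the boundary is immediate.

Away from `0` the first three maps are given by a pair of formulas `radius` and `angle` free of case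
distinctions, built from `maxNorm x` and `x i / maxNorm x` by Lipschitz operations
(`mapU3_mapU2_mapU1`). Hence the Lipschitz constant near `x` is at most `C / maxNorm x`
(`exists_leakMap_bound`), and off finitely many curves the Jacobian is positive and of at most that
size (`ae_leakMap`), which is `p`-integrable for `p < 2`. Almost every line parallel to an axis
avoids `0`, so Green's formula with boundary values `bendMap α` follows from Fubini's theorem and
the fundamental theorem of calculus (`green`); it yields the weak gradient and the trace.

A test function with compact support in the rectangle stays away from `0`, where the map is
Lipschitz. The integrand of the divergence identity is `dF₀ ∧ du₁ - dF₁ ∧ du₀` with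
`Fᵢ = φ gᵢ(u)`, and such Jacobians have integral zero for Lipschitz functions
(`integral_jacobian_eq_zero`), so the identities hold in the interior.

Up to the boundary they fail because of the leaked material, whose angle goes below `-1`. The image
of the boundary leaves free a sector around the negative horizontal axis, and only leaked material
enters it. With `φ = 1` and a field supported there (`gapField`) the boundary term vanishes, but the
interior term is the integral of the Jacobian times a function that is nonpositive on the rectangle
and negative on a nonempty open set (`integral_det_mul_divergence_neg`). As weak gradient and trace
are unique, no other choice of them helps.

Finally, for `4 π / 5 < α` the tongue is so long that, bent around the origin by `mapU4 α`, it
reaches the material that lies one full turn further. The points with the same image are related by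
an explicit shear of the central sector (`leakMap_sinkShear`), whose inverse is differentiable and
thus preserves null sets; so removing a null set cannot restore injectivity.
-/

noncomputable section

/-! ### A formula for the map without case distinctions -/

/-- The horizontal contraction factor of the part of the material that passes through the cavity,
as a function of its height `t`; it vanishes at `t = 0`, where the material is pinched. -/
def pinch (t : ℝ) : ℝ :=
  4 * |max (-(1 / 4)) (min t (3 / 4))| / (4 * max (-(1 / 4)) (min t (3 / 4)) + 3)

/-- The height to which `mapU2 ∘ mapU1` moves a point of the sector `|x₁| ≤ x₂`. -/
def sinkHeight (x : Plane) : ℝ :=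
  1 - (1 - maxNorm x) / 4 * max (7 - 8 * |mapU1 x 0|) 1

/-- The radius assigned to a point by `mapU3 ∘ mapU2 ∘ mapU1`, in a single formula without case
distinction. -/
def radius (x : Plane) : ℝ :=
  3 / 2 + mapU1 x 0 * pinch (sinkHeight x)
    - 1 / 2 * (x 0 / maxNorm x) * (1 - maxNorm x) * max (3 / 4 - mapU1 x 1) 0

/-- The angle, in units of `α`, assigned to a point by `mapU3 ∘ mapU2 ∘ mapU1`, in a single formula
without case distinction. -/
def angle (x : Plane) : ℝ :=
  2 * (mapU1 x 1 - 2 * (1 - maxNorm x) * max (3 / 4 - |mapU1 x 0|) 0) - 1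

theorem mapU3_mk (a b : ℝ) : mapU3 !₂[a, b] =
    if (0 ≤ b ∧ b < 3 / 4) ∧ 3 / 4 < |a| then
      !₂[1 / 2 * (Real.sign a * (1 - 4 * (1 - |a|) * (1 - b)) + 3), 2 * b - 1]
    else if |a| < (4 * b + 3) / 8 ∧ (0 ≤ b ∧ b < 3 / 4) then
      !₂[4 * a * b / (4 * b + 3) + 3 / 2, 2 * b - 1]
    else if |a| < (4 * b + 3) / 8 ∧ (-(1 / 4) ≤ b ∧ b < 0) then
      !₂[-4 * a * b / (4 * b + 3) + 3 / 2, 2 * b - 1]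
    else !₂[(a + 3) / 2, 2 * b - 1] := rfl

theorem mapU1_apply (x : Plane) (i : Fin 2) :
    mapU1 x i = (maxNorm x + 3) / (4 * maxNorm x) * x i := rfl

theorem pinch_of_ge {t : ℝ} (h : 3 / 4 ≤ t) : pinch t = 1 / 2 := by
  rw [pinch, min_eq_right h, max_eq_right (by norm_num), abs_of_pos (by norm_num)]; norm_num

theorem pinch_of_le {t : ℝ} (h : t ≤ -(1 / 4)) : pinch t = 1 / 2 := by
  rw [pinch, min_eq_left (by linarith), max_eq_left h]; norm_num

theorem pinch_of_mem {t : ℝ} (h : -(1 / 4) ≤ t) (h' : t ≤ 3 / 4) :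
    pinch t = 4 * |t| / (4 * t + 3) := by
  rw [pinch, min_eq_left h', max_eq_right h]

theorem pinch_nonneg (t : ℝ) : 0 ≤ pinch t := by
  have : -(1 / 4) ≤ max (-(1 / 4)) (min t (3 / 4)) := le_max_left _ _
  unfold pinch
  apply div_nonneg (by positivity) (by linarith)

theorem pinch_le (t : ℝ) : pinch t ≤ 1 / 2 := by
  have h1 : -(1 / 4) ≤ max (-(1 / 4)) (min t (3 / 4)) := le_max_left _ _
  have h2 : max (-(1 / 4)) (min t (3 / 4)) ≤ 3 / 4 := max_le (by norm_num) (min_le_right _ _)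
  unfold pinch
  rw [div_le_iff₀ (by linarith)]
  rcases abs_cases (max (-(1 / 4)) (min t (3 / 4))) with h | h <;> linarith

theorem pinch_pos {t : ℝ} (h : t ≠ 0) : 0 < pinch t := by
  have h1 : -(1 / 4) ≤ max (-(1 / 4)) (min t (3 / 4)) := le_max_left _ _
  unfold pinch
  apply div_pos _ (by linarith)
  have : max (-(1 / 4)) (min t (3 / 4)) ≠ 0 := by
    rcases lt_or_gt_of_ne h with h | h
    · exact ne_of_lt (max_lt (by norm_num) (min_lt_of_left_lt h))
    · exact ne_of_gt (lt_max_of_lt_right (lt_min h (by norm_num)))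
  positivity

theorem abs_apply_le_maxNorm (x : Plane) (i : Fin 2) : |x i| ≤ maxNorm x := by
  fin_cases i
  · exact le_max_left _ _
  · exact le_max_right _ _

theorem maxNorm_eq_of_side {x : Plane} (hb : 0 ≤ x 1) (h : x 1 ≤ |x 0|) : maxNorm x = |x 0| := by
  rw [maxNorm, abs_of_nonneg hb, max_eq_left h]

theorem maxNorm_eq_of_top {x : Plane} (h : |x 0| ≤ x 1) : maxNorm x = x 1 := by
  rw [maxNorm, abs_of_nonneg ((abs_nonneg _).trans h), max_eq_right h]

theorem abs_mapU1_side {x : Plane} (hb : 0 ≤ x 1) (h : x 1 ≤ |x 0|) (hs : 0 < maxNorm x) :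
    |mapU1 x 0| = (maxNorm x + 3) / 4 := by
  rw [mapU1_apply, abs_mul, abs_of_pos (by positivity), ← maxNorm_eq_of_side hb h]
  field_simp

theorem mapU1_top {x : Plane} (h : |x 0| ≤ x 1) (hs : 0 < maxNorm x) :
    mapU1 x 1 = (maxNorm x + 3) / 4 := by
  rw [mapU1_apply, ← maxNorm_eq_of_top h]
  field_simp

/-- On the lateral sectors `x₂ ≤ |x₁|` the material is not lowered. -/
theorem radius_side {x : Plane} (hb : 0 ≤ x 1) (h : x 1 ≤ |x 0|) (hs : 0 < maxNorm x) :
    radius x = 3 / 2 + mapU1 x 0 / 2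
      - 1 / 2 * (x 0 / maxNorm x) * (1 - maxNorm x) * max (3 / 4 - mapU1 x 1) 0 := by
  have h0 := abs_mapU1_side hb h hs
  rw [radius, pinch_of_ge]
  · ring
  · rw [sinkHeight, h0, max_eq_right (by linarith)]
    linarith

theorem angle_side {x : Plane} (hb : 0 ≤ x 1) (h : x 1 ≤ |x 0|) (hs : 0 < maxNorm x) :
    angle x = 2 * mapU1 x 1 - 1 := by
  have h0 := abs_mapU1_side hb h hs
  rw [angle, h0, max_eq_right (by linarith)]
  ring

theorem radius_top {x : Plane} (h : |x 0| ≤ x 1) (hs : 0 < maxNorm x) :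
    radius x = 3 / 2 + mapU1 x 0 * pinch (sinkHeight x) := by
  rw [radius, mapU1_top h hs, max_eq_right (by linarith)]
  ring

theorem angle_top {x : Plane} (h : |x 0| ≤ x 1) (hs : 0 < maxNorm x) :
    angle x = 2 * sinkHeight x - 1 := by
  rw [angle, sinkHeight, mapU1_top h hs]
  rcases le_total |mapU1 x 0| (3 / 4) with h' | h'
  · rw [max_eq_left (by linarith), max_eq_left (by linarith)]; ring
  · rw [max_eq_right (by linarith), max_eq_right (by linarith)]; ring

/-- In the central sector the lowered material stays inside the cone
`|y₁| < (4 t + 3) / 8` which `mapU3` pinches. -/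
theorem abs_mapU1_lt_of_sinkHeight {x : Plane} (hs : 0 < maxNorm x) (h : |mapU1 x 0| < 3 / 4) :
    |mapU1 x 0| < (4 * sinkHeight x + 3) / 8 := by
  rw [sinkHeight, max_eq_left (by linarith)]
  nlinarith

/-- On the closed rectangle without the point `0`, the composition `mapU3 ∘ mapU2 ∘ mapU1` is given
by `radius` and `angle`. -/
theorem mapU3_mapU2_mapU1 {x : Plane} (hb : 0 ≤ x 1) (hs : 0 < maxNorm x) :
    mapU3 (mapU2 (mapU1 x)) = !₂[radius x, angle x] := by
  have hk : 0 < (maxNorm x + 3) / (4 * maxNorm x) := by positivity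
  rcases le_total (x 1) |x 0| with h | h
  · have h0 := abs_mapU1_side hb h hs
    have hy1 : 0 ≤ mapU1 x 1 := by rw [mapU1_apply]; positivity
    have h2 : mapU2 (mapU1 x) = mapU1 x := if_neg (by rw [h0]; linarith)
    rw [h2, radius_side hb h hs, angle_side hb h hs, mapU3]
    by_cases hy : mapU1 x 1 < 3 / 4
    · rw [if_pos ⟨⟨hy1, hy⟩, by rw [h0]; linarith⟩, max_eq_left (by linarith), h0]
      congr 3
      have hx0 : x 0 ≠ 0 := by
        rw [maxNorm_eq_of_side hb h] at hs
        exact abs_pos.1 hs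
      have hsgn : Real.sign (mapU1 x 0) = x 0 / maxNorm x := by
        rw [maxNorm_eq_of_side hb h]
        rcases lt_or_gt_of_ne hx0 with h' | h'
        · rw [Real.sign_of_neg, abs_of_neg h', div_neg, div_self hx0]
          rw [mapU1_apply]; exact mul_neg_of_pos_of_neg hk h'
        · rw [Real.sign_of_pos, abs_of_pos h', div_self hx0]
          rw [mapU1_apply]; positivity
      rw [hsgn, mapU1_apply x 0]
      field_simp
      ring
    · rw [if_neg (by tauto), if_neg (by tauto), if_neg (by intro h'; linarith [h'.2.2]),
        max_eq_right (by linarith)]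
      congr 3
      ring
  · have h1 := mapU1_top h hs
    rw [radius_top h hs, angle_top h hs]
    by_cases hy : |mapU1 x 0| < 3 / 4
    · have h2 : mapU2 (mapU1 x) = !₂[mapU1 x 0, sinkHeight x] := by
        rw [mapU2, if_pos hy, h1, sinkHeight, max_eq_left (by linarith)]
        congr 2
        ring_nf
      have h3 := abs_mapU1_lt_of_sinkHeight hs hy
      rw [h2, mapU3_mk]
      rw [if_neg (by intro h'; linarith [h'.2])]
      by_cases ha : 0 ≤ sinkHeight x ∧ sinkHeight x < 3 / 4
      · rw [if_pos ⟨h3, ha⟩, pinch_of_mem (by linarith) ha.2.le, abs_of_nonneg ha.1]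
        congr 2
        ring
      · rw [if_neg (by tauto)]
        by_cases hc : -(1 / 4) ≤ sinkHeight x ∧ sinkHeight x < 0
        · rw [if_pos ⟨h3, hc⟩, pinch_of_mem hc.1 (by linarith), abs_of_neg hc.2]
          congr 2
          ring
        · rw [if_neg (by tauto)]
          have : pinch (sinkHeight x) = 1 / 2 := by
            rcases lt_or_ge (sinkHeight x) 0 with h' | h'
            · exact pinch_of_le (by by_contra h''; exact hc ⟨by linarith, h'⟩)
            · exact pinch_of_ge (by by_contra h''; exact ha ⟨h', by linarith⟩)
          rw [this]
          congr 3
          ring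
    · have h2 : mapU2 (mapU1 x) = mapU1 x := if_neg hy
      have h3 : sinkHeight x = mapU1 x 1 := by
        rw [sinkHeight, max_eq_right (by linarith), h1]; ring
      rw [h2, h3, pinch_of_ge (by linarith), mapU3, if_neg (by intro h'; linarith [h'.1.2]),
        if_neg (by intro h'; linarith [h'.2.2]), if_neg (by intro h'; linarith [h'.2.2])]
      congr 3
      ring

theorem abs_mapU1_le_one {x : Plane} (hs : 0 < maxNorm x) (hs1 : maxNorm x ≤ 1) (i : Fin 2) :
    |mapU1 x i| ≤ 1 := by
  rw [mapU1_apply, abs_mul, abs_of_pos (by positivity)]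
  calc _ ≤ (maxNorm x + 3) / (4 * maxNorm x) * maxNorm x := by
        gcongr; exact abs_apply_le_maxNorm x i
    _ = (maxNorm x + 3) / 4 := by field_simp
    _ ≤ 1 := by linarith

theorem abs_radius_sub_le {x : Plane} (hb : 0 ≤ x 1) (hs : 0 < maxNorm x) (hs1 : maxNorm x ≤ 1) :
    |radius x - 3 / 2| ≤ 1 / 2 := by
  have hk : 0 < (maxNorm x + 3) / (4 * maxNorm x) := by positivity
  rcases le_total (x 1) |x 0| with h | h
  · have h0 := abs_mapU1_side hb h hs
    have hy1 : 0 ≤ mapU1 x 1 := by rw [mapU1_apply]; positivity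
    have hx : x 0 ≠ 0 := by
      rw [maxNorm_eq_of_side hb h] at hs
      exact abs_pos.1 hs
    have e : radius x - 3 / 2 = (x 0 / maxNorm x) *
        (((maxNorm x + 3) / 4 - (1 - maxNorm x) * max (3 / 4 - mapU1 x 1) 0) / 2) := by
      rw [radius_side hb h hs, mapU1_apply x 0]; field_simp; ring
    have e' : |x 0 / maxNorm x| = 1 := by
      rw [abs_div, abs_of_pos hs, maxNorm_eq_of_side hb h, div_self (abs_pos.2 hx).ne']
    rw [e, abs_mul, e', one_mul]
    have m1 : 0 ≤ max (3 / 4 - mapU1 x 1) 0 := le_max_right _ _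
    have m2 : max (3 / 4 - mapU1 x 1) 0 ≤ 3 / 4 := max_le (by linarith) (by norm_num)
    rw [abs_le]
    constructor <;> nlinarith
  · rw [radius_top h hs]
    have := pinch_le (sinkHeight x)
    have h' := pinch_nonneg (sinkHeight x)
    rw [add_sub_cancel_left, abs_mul, abs_of_nonneg h']
    have := abs_mapU1_le_one hs hs1 0
    nlinarith [abs_nonneg (mapU1 x 0)]

theorem leakMap_eq {α : ℝ} {x : Plane} (hb : 0 ≤ x 1) (hs : 0 < maxNorm x) :
    leakMap α x = mapU4 α !₂[radius x, angle x] := by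
  rw [← mapU3_mapU2_mapU1 hb hs]; rfl

/-- Material with an angle below that of the bottom of the rectangle has leaked through the cavity,
and lies close to its axis. -/
theorem abs_radius_sub_lt_of_angle_lt {x : Plane} (hb : 0 ≤ x 1) (hs : 0 < maxNorm x)
    (hang : angle x < -1) : |radius x - 3 / 2| < 1 / 4 := by
  have hk : 0 < (maxNorm x + 3) / (4 * maxNorm x) := by positivity
  rcases le_total (x 1) |x 0| with h | h
  · have hy1 : 0 ≤ mapU1 x 1 := by rw [mapU1_apply]; positivity
    rw [angle_side hb h hs] at hang
    linarith
  · rw [angle_top h hs] at hang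
    have h3 : |mapU1 x 0| < 3 / 4 := by
      by_contra h'
      have h1 := mapU1_top h hs
      have h3 : sinkHeight x = mapU1 x 1 := by
        rw [sinkHeight, max_eq_right (by linarith), h1]; ring
      linarith
    have h4 := abs_mapU1_lt_of_sinkHeight hs h3
    have := pinch_le (sinkHeight x)
    have h' := pinch_nonneg (sinkHeight x)
    rw [radius_top h hs, add_sub_cancel_left, abs_mul, abs_of_nonneg h']
    nlinarith [abs_nonneg (mapU1 x 0)]

/-! ### Lipschitz constants inversely proportional to the distance from the cavity -/

/-- The punctured closed unit ball of the maximum norm. -/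
def puncturedBox : Set Plane := {x | 0 < maxNorm x ∧ maxNorm x ≤ 1}

/-- `f` is bounded on the punctured box, and its increments from `x` are at most
`C / maxNorm x` times the displacement. -/
def ConeLipschitz (f : Plane → ℝ) : Prop :=
  ∃ C, 0 ≤ C ∧ ∀ x ∈ puncturedBox, |f x| ≤ C ∧
    ∀ y ∈ puncturedBox, |f x - f y| ≤ C / maxNorm x * ‖x - y‖

theorem abs_apply_le_norm (x : Plane) (i : Fin 2) : |x i| ≤ ‖x‖ := PiLp.norm_apply_le x i

theorem maxNorm_le_norm (x : Plane) : maxNorm x ≤ ‖x‖ :=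
  max_le (abs_apply_le_norm x 0) (abs_apply_le_norm x 1)

theorem abs_maxNorm_sub_le (x y : Plane) : |maxNorm x - maxNorm y| ≤ ‖x - y‖ := by
  have h := abs_max_sub_max_le_max |x 0| |x 1| |y 0| |y 1|
  refine h.trans (max_le ?_ ?_)
  · exact (abs_abs_sub_abs_le _ _).trans (abs_apply_le_norm (x - y) 0)
  · exact (abs_abs_sub_abs_le _ _).trans (abs_apply_le_norm (x - y) 1)

namespace ConeLipschitz

theorem const (c : ℝ) : ConeLipschitz fun _ => c :=
  ⟨|c|, abs_nonneg c, fun x hx => ⟨le_rfl, fun y _ => by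
    have := hx.1
    simp only [sub_self, abs_zero]; positivity⟩⟩

theorem maxNorm : ConeLipschitz maxNorm :=
  ⟨1, zero_le_one, fun x hx => ⟨by rw [abs_of_pos hx.1]; exact hx.2, fun y _ =>
    (abs_maxNorm_sub_le x y).trans
      (le_mul_of_one_le_left (norm_nonneg _) (by rw [le_div_iff₀ hx.1]; linarith [hx.2]))⟩⟩

theorem apply_div_maxNorm (i : Fin 2) : ConeLipschitz fun x => x i / _root_.maxNorm x := by
  have hb : ∀ x ∈ puncturedBox, |x i / _root_.maxNorm x| ≤ 1 := fun x hx => by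
    rw [abs_div, abs_of_pos hx.1, div_le_one hx.1]; exact abs_apply_le_maxNorm x i
  refine ⟨2, zero_le_two, fun x hx => ⟨(hb x hx).trans one_le_two, fun y hy => ?_⟩⟩
  have hx0 := hx.1
  have hy0 := hy.1
  have e : x i / _root_.maxNorm x - y i / _root_.maxNorm y
      = ((x i - y i) + y i / _root_.maxNorm y * (_root_.maxNorm y - _root_.maxNorm x))
        / _root_.maxNorm x := by
    field_simp; ring
  rw [e, abs_div, abs_of_pos hx0,
    show 2 / _root_.maxNorm x * ‖x - y‖ = 2 * ‖x - y‖ / _root_.maxNorm x by ring]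
  gcongr
  have h1 : |x i - y i| ≤ ‖x - y‖ := abs_apply_le_norm (x - y) i
  have h2 := abs_maxNorm_sub_le y x
  rw [norm_sub_rev] at h2
  calc _ ≤ |x i - y i| + |y i / _root_.maxNorm y * (_root_.maxNorm y - _root_.maxNorm x)| :=
        abs_add_le _ _
    _ ≤ ‖x - y‖ + 1 * ‖x - y‖ := by
        rw [abs_mul]; gcongr; exact hb y hy
    _ = _ := by ring

variable {f g : Plane → ℝ}

theorem congr (hf : ConeLipschitz f) (h : ∀ x ∈ puncturedBox, g x = f x) : ConeLipschitz g := by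
  obtain ⟨C, hC, H⟩ := hf
  refine ⟨C, hC, fun x hx => ⟨by rw [h x hx]; exact (H x hx).1, fun y hy => ?_⟩⟩
  rw [h x hx, h y hy]; exact (H x hx).2 y hy

theorem add (hf : ConeLipschitz f) (hg : ConeLipschitz g) : ConeLipschitz fun x => f x + g x := by
  obtain ⟨C, hC, H⟩ := hf
  obtain ⟨D, hD, H'⟩ := hg
  refine ⟨C + D, by positivity, fun x hx => ⟨?_, fun y hy => ?_⟩⟩
  · exact (abs_add_le _ _).trans (add_le_add (H x hx).1 (H' x hx).1)
  · calc |f x + g x - (f y + g y)| = |(f x - f y) + (g x - g y)| := by ring_nf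
      _ ≤ |f x - f y| + |g x - g y| := abs_add_le _ _
      _ ≤ C / _root_.maxNorm x * ‖x - y‖ + D / _root_.maxNorm x * ‖x - y‖ :=
          add_le_add ((H x hx).2 y hy) ((H' x hx).2 y hy)
      _ = _ := by ring

theorem mul (hf : ConeLipschitz f) (hg : ConeLipschitz g) : ConeLipschitz fun x => f x * g x := by
  obtain ⟨C, hC, H⟩ := hf
  obtain ⟨D, hD, H'⟩ := hg
  refine ⟨C * D + C * D, by positivity, fun x hx => ⟨?_, fun y hy => ?_⟩⟩
  · rw [abs_mul]
    have := mul_le_mul (H x hx).1 (H' x hx).1 (abs_nonneg _) hC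
    nlinarith [mul_nonneg hC hD]
  · calc |f x * g x - f y * g y| = |(f x - f y) * g x + f y * (g x - g y)| := by ring_nf
      _ ≤ |f x - f y| * |g x| + |f y| * |g x - g y| := by
          rw [← abs_mul, ← abs_mul]; exact abs_add_le _ _
      _ ≤ C / _root_.maxNorm x * ‖x - y‖ * D + C * (D / _root_.maxNorm x * ‖x - y‖) := by
          have := hx.1
          exact add_le_add
            (mul_le_mul ((H x hx).2 y hy) (H' x hx).1 (abs_nonneg _) (by positivity))
            (mul_le_mul (H y hy).1 ((H' x hx).2 y hy) (abs_nonneg _) hC)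
      _ = _ := by ring

theorem comp {h : ℝ → ℝ} {L : ℝ} (hL : 0 ≤ L) (hh : ∀ a b, |h a - h b| ≤ L * |a - b|)
    (hf : ConeLipschitz f) : ConeLipschitz fun x => h (f x) := by
  obtain ⟨C, hC, H⟩ := hf
  refine ⟨L * C + |h 0|, by positivity, fun x hx => ⟨?_, fun y hy => ?_⟩⟩
  · have h1 := hh (f x) 0
    have h2 := abs_add_le (h (f x) - h 0) (h 0)
    rw [sub_add_cancel] at h2
    rw [sub_zero] at h1
    nlinarith [(H x hx).1]
  · have hx0 := hx.1
    calc _ ≤ L * |f x - f y| := hh _ _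
      _ ≤ L * (C / _root_.maxNorm x * ‖x - y‖) := by gcongr; exact (H x hx).2 y hy
      _ = (L * C) / _root_.maxNorm x * ‖x - y‖ := by ring
      _ ≤ _ := by gcongr; linarith [abs_nonneg (h 0)]

theorem const_mul (c : ℝ) (hf : ConeLipschitz f) : ConeLipschitz fun x => c * f x :=
  (const c).mul hf

theorem sub (hf : ConeLipschitz f) (hg : ConeLipschitz g) : ConeLipschitz fun x => f x - g x :=
  (hf.add (hg.const_mul (-1))).congr fun x _ => by ring

theorem abs (hf : ConeLipschitz f) : ConeLipschitz fun x => |f x| :=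
  hf.comp zero_le_one fun a b => by rw [one_mul]; exact abs_abs_sub_abs_le a b

theorem max_const (hf : ConeLipschitz f) (c : ℝ) : ConeLipschitz fun x => max (f x) c :=
  hf.comp (h := fun t => max t c) zero_le_one fun a b => by
    rw [one_mul]; exact abs_max_sub_max_le_abs a b c

end ConeLipschitz

theorem abs_pinch_sub_le (a b : ℝ) : |pinch a - pinch b| ≤ 4 * |a - b| := by
  have key : ∀ c d : ℝ, -(1 / 4) ≤ c → c ≤ 3 / 4 → -(1 / 4) ≤ d → d ≤ 3 / 4 →
      |4 * |c| / (4 * c + 3) - 4 * |d| / (4 * d + 3)| ≤ 4 * |c - d| := by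
    intro c d hc hc' hd hd'
    have h1 : 2 ≤ 4 * c + 3 := by linarith
    have h2 : 2 ≤ 4 * d + 3 := by linarith
    have e : 4 * |c| / (4 * c + 3) - 4 * |d| / (4 * d + 3)
        = (12 * (|c| - |d|) + 16 * (|c| * d - |d| * c)) / ((4 * c + 3) * (4 * d + 3)) := by
      field_simp; ring
    rw [e, abs_div, abs_of_pos (show 0 < (4 * c + 3) * (4 * d + 3) by positivity),
      div_le_iff₀ (by positivity)]
    have h3 : 4 ≤ (4 * c + 3) * (4 * d + 3) := by nlinarith
    have h4 : |12 * (|c| - |d|) + 16 * (|c| * d - |d| * c)| ≤ 16 * |c - d| := by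
      rcases abs_cases c with ⟨p, p'⟩ | ⟨p, p'⟩ <;> rcases abs_cases d with ⟨q, q'⟩ | ⟨q, q'⟩ <;>
        rcases abs_cases (c - d) with ⟨r, r'⟩ | ⟨r, r'⟩ <;> rw [p, q, r, abs_le] <;>
        constructor <;> nlinarith
    nlinarith [abs_nonneg (c - d)]
  have hcl : |max (-(1 / 4)) (min a (3 / 4)) - max (-(1 / 4)) (min b (3 / 4))| ≤ |a - b| := by
    have h1 := abs_max_sub_max_le_max (-(1 / 4)) (min a (3 / 4)) (-(1 / 4)) (min b (3 / 4))
    have h2 := abs_min_sub_min_le_max a (3 / 4) b (3 / 4)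
    simp only [sub_self, abs_zero] at h1 h2
    rw [max_eq_right (abs_nonneg (min a (3 / 4) - min b (3 / 4)))] at h1
    rw [max_eq_left (abs_nonneg _)] at h2
    exact h1.trans h2
  have hm : ∀ t : ℝ, max (-(1 / 4)) (min t (3 / 4)) ≤ 3 / 4 :=
    fun t => max_le (by norm_num) (min_le_right _ _)
  exact (key _ _ (le_max_left _ _) (hm a) (le_max_left _ _) (hm b)).trans (by gcongr)

theorem coneLipschitz_mapU1 (i : Fin 2) : ConeLipschitz fun x => mapU1 x i :=
  (((ConeLipschitz.maxNorm.add (.const 3)).const_mul (1 / 4)).mul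
    (.apply_div_maxNorm i)).congr fun x hx => by
      have := hx.1
      rw [mapU1_apply]; field_simp

theorem coneLipschitz_radius : ConeLipschitz radius := by
  have hz : ConeLipschitz sinkHeight :=
    ((ConeLipschitz.const 1).sub ((((ConeLipschitz.const 1).sub .maxNorm).const_mul (1 / 4)).mul
      (((ConeLipschitz.const 7).sub ((coneLipschitz_mapU1 0).abs.const_mul 8)).max_const 1))).congr
      fun x _ => by rw [sinkHeight]; ring
  exact (((ConeLipschitz.const (3 / 2)).add
    ((coneLipschitz_mapU1 0).mul (hz.comp (by norm_num) abs_pinch_sub_le))).sub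
    ((((ConeLipschitz.apply_div_maxNorm 0).const_mul (1 / 2)).mul
      ((ConeLipschitz.const 1).sub .maxNorm)).mul
      (((ConeLipschitz.const (3 / 4)).sub (coneLipschitz_mapU1 1)).max_const 0)))

theorem coneLipschitz_angle : ConeLipschitz angle :=
  ((((coneLipschitz_mapU1 1).sub ((((ConeLipschitz.const 1).sub .maxNorm).const_mul 2).mul
    (((ConeLipschitz.const (3 / 4)).sub (coneLipschitz_mapU1 0).abs).max_const 0))).const_mul 2).sub
    (.const 1))

theorem coneLipschitz_mapU4 (α : ℝ) (i : Fin 2) :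
    ConeLipschitz fun x => mapU4 α !₂[radius x, angle x] i := by
  have h := coneLipschitz_angle.const_mul α
  fin_cases i
  · exact coneLipschitz_radius.mul (h.comp zero_le_one fun a b => by
      rw [one_mul]; exact Real.abs_cos_sub_cos_le a b)
  · exact coneLipschitz_radius.mul (h.comp zero_le_one fun a b => by
      rw [one_mul]; exact Real.abs_sin_sub_sin_le a b)

/-- The closed rectangle without the point at which the cavity is opened. -/
def puncturedRect : Set Plane := {x | -1 ≤ x 0 ∧ x 0 ≤ 1 ∧ 0 ≤ x 1 ∧ x 1 ≤ 1 ∧ 0 < maxNorm x}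

theorem puncturedRect_subset : puncturedRect ⊆ puncturedBox := fun _ hx =>
  ⟨hx.2.2.2.2, max_le (abs_le.2 ⟨hx.1, hx.2.1⟩) (abs_le.2 ⟨by linarith [hx.2.2.1], hx.2.2.2.1⟩)⟩

theorem maxNorm_pos_of_rect {x : Plane} (hx : x ∈ rect) : 0 < maxNorm x :=
  lt_max_of_lt_right (abs_pos.2 hx.2.2.1.ne')

theorem rect_subset : rect ⊆ puncturedRect := fun _ hx =>
  ⟨hx.1.le, hx.2.1.le, hx.2.2.1.le, hx.2.2.2.le, maxNorm_pos_of_rect hx⟩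

/-- The composite map is bounded, and its Lipschitz constant away from the cavity grows at most like
the inverse of the distance from it. -/
theorem exists_leakMap_bound (α : ℝ) : ∃ C, 0 ≤ C ∧ ∀ i, ∀ x ∈ puncturedRect, |leakMap α x i| ≤ C ∧
    ∀ y ∈ puncturedRect, |leakMap α x i - leakMap α y i| ≤ C / maxNorm x * ‖x - y‖ := by
  choose C hC H using coneLipschitz_mapU4 α
  refine ⟨C 0 + C 1, add_nonneg (hC 0) (hC 1), fun i x hx => ?_⟩
  have hi : C i ≤ C 0 + C 1 := by
    fin_cases i
    · exact le_add_of_nonneg_right (hC 1)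
    · exact le_add_of_nonneg_left (hC 0)
  have hx0 := hx.2.2.2.2
  rw [leakMap_eq hx.2.2.1 hx0]
  refine ⟨((H i x (puncturedRect_subset hx)).1).trans hi, fun y hy => ?_⟩
  rw [leakMap_eq hy.2.2.1 hy.2.2.2.2]
  refine ((H i x (puncturedRect_subset hx)).2 y (puncturedRect_subset hy)).trans ?_
  gcongr

/-! ### The plane as a product -/

/-- The identification of `ℝ × ℝ` with the plane. -/
def planeEquiv : ℝ × ℝ ≃ᵐ Plane :=
  MeasurableEquiv.finTwoArrow.symm.trans (MeasurableEquiv.toLp 2 (Fin 2 → ℝ))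

theorem planeEquiv_zero (p : ℝ × ℝ) : planeEquiv p 0 = p.1 := rfl

theorem planeEquiv_one (p : ℝ × ℝ) : planeEquiv p 1 = p.2 := rfl

theorem measurePreserving_planeEquiv : MeasurePreserving planeEquiv volume volume :=
  (EuclideanSpace.volume_preserving_symm_measurableEquiv_toLp (Fin 2)).symm.comp
    (volume_preserving_finTwoArrow ℝ).symm

/-- Pairs of mirror-symmetric graphs over the vertical axis are null sets. -/
theorem ae_abs_ne {h : ℝ → ℝ} (hm : Measurable h) : ∀ᵐ x : Plane, |x 0| ≠ h (x 1) := by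
  have hS : MeasurableSet {p : ℝ × ℝ | |p.1| = h p.2} :=
    measurableSet_eq_fun (by fun_prop) (by fun_prop)
  have h0 : ∀ᵐ p : ℝ × ℝ, |p.1| ≠ h p.2 := by
    rw [ae_iff]
    simp only [ne_eq, not_not]
    rw [Measure.volume_eq_prod, Measure.prod_apply_symm hS]
    refine lintegral_eq_zero_of_ae_eq_zero (Eventually.of_forall fun y => ?_)
    refine Set.Finite.measure_zero (Set.Finite.subset (Set.toFinite {h y, -h y}) ?_) _
    intro t ht
    have ht' : |t| = h y := ht
    rcases abs_choice t with h' | h' <;> rw [h'] at ht'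
    · exact Or.inl ht'
    · exact Or.inr (by simp [← ht'])
  exact (measurePreserving_planeEquiv.symm planeEquiv).quasiMeasurePreserving.ae
    (p := fun p : ℝ × ℝ => |p.1| ≠ h p.2) h0

/-! ### The derivative of the map -/

/-- The Jacobian determinant of a pair of linear forms on the plane. -/
def jac (A B : Plane →L[ℝ] ℝ) : ℝ :=
  A (EuclideanSpace.single 0 1) * B (EuclideanSpace.single 1 1)
    - A (EuclideanSpace.single 1 1) * B (EuclideanSpace.single 0 1)

theorem hasFDerivAt_coord (i : Fin 2) (x : Plane) :
    HasFDerivAt (fun z : Plane => z i) (EuclideanSpace.proj i : Plane →L[ℝ] ℝ) x :=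
  (EuclideanSpace.proj i : Plane →L[ℝ] ℝ).hasFDerivAt

theorem hasDerivAt_dilation {t : ℝ} (ht : t ≠ 0) :
    HasDerivAt (fun t : ℝ => (t + 3) / (4 * t)) (-3 / (4 * t ^ 2)) t := by
  have h := ((hasDerivAt_id t).add_const 3).div ((hasDerivAt_id t).const_mul 4)
    (by simpa using ht)
  refine h.congr_deriv ?_
  simp only [id]
  field_simp
  ring

theorem differentiableAt_pinch {t : ℝ} (h1 : t ≠ -(1 / 4)) (h2 : t ≠ 0) (h3 : t ≠ 3 / 4) :
    DifferentiableAt ℝ pinch t := by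
  rcases lt_or_gt_of_ne h1 with h | h
  · refine (differentiableAt_const (1 / 2 : ℝ)).congr_of_eventuallyEq ?_
    filter_upwards [Iio_mem_nhds h] with z hz using pinch_of_le (le_of_lt hz)
  rcases lt_or_gt_of_ne h3 with h' | h'
  · have : DifferentiableAt ℝ (fun t : ℝ => 4 * |t| / (4 * t + 3)) t :=
      ((differentiableAt_abs h2).const_mul 4).div (by fun_prop) (by linarith)
    refine this.congr_of_eventuallyEq ?_
    filter_upwards [Ioo_mem_nhds h h'] with z hz using pinch_of_mem hz.1.le hz.2.le
  · refine (differentiableAt_const (1 / 2 : ℝ)).congr_of_eventuallyEq ?_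
    filter_upwards [Ioi_mem_nhds h'] with z hz using pinch_of_ge (le_of_lt hz)

/-- The sign of the first coordinate is locally constant off the vertical axis. -/
theorem exists_sign {x : Plane} (hx : x 0 ≠ 0) :
    ∃ σ : ℝ, σ * σ = 1 ∧ ∀ᶠ z : Plane in 𝓝 x, |z 0| = σ * z 0 := by
  have hc : Continuous fun z : Plane => z 0 := by fun_prop
  rcases lt_or_gt_of_ne hx with h | h
  · refine ⟨-1, by norm_num, ?_⟩
    filter_upwards [hc.continuousAt.eventually_lt_const h] with z hz
    rw [abs_of_neg hz]; ring
  · refine ⟨1, by norm_num, ?_⟩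
    filter_upwards [hc.continuousAt.eventually_const_lt h] with z hz
    rw [abs_of_pos hz]; ring

theorem dilation_le {s : ℝ} (h0 : 0 < s) (h1 : s ≤ 1) : (s + 3) / (4 * s) ≤ 1 / s := by
  rw [div_le_div_iff₀ (by positivity) h0]; nlinarith

/-- Radius and angle are differentiable with positive Jacobian in the lateral sectors. -/
theorem exists_jac_side {x : Plane} (hb : 0 < x 1) (h : x 1 < |x 0|) (hs1 : maxNorm x ≤ 1)
    (h3 : mapU1 x 1 ≠ 3 / 4) :
    ∃ R T, HasFDerivAt radius R x ∧ HasFDerivAt angle T x ∧ 0 < jac R T ∧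
      jac R T ≤ 2 / maxNorm x := by
  have hx0 : x 0 ≠ 0 := abs_pos.1 (hb.trans h)
  have hs : 0 < maxNorm x := by rw [maxNorm_eq_of_side hb.le h.le]; exact hb.trans h
  obtain ⟨σ, hσ, hev⟩ := exists_sign hx0
  have c0 : Continuous fun z : Plane => z 0 := by fun_prop
  have c1 : Continuous fun z : Plane => z 1 := by fun_prop
  have hev' : ∀ᶠ z : Plane in 𝓝 x, 0 < z 1 ∧ z 1 < |z 0| ∧ |z 0| = σ * z 0 := by
    filter_upwards [hev, c1.continuousAt.eventually_const_lt hb,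
      c1.continuousAt.eventually_lt c0.abs.continuousAt h] with z h1 h2 h3 using ⟨h2, h3, h1⟩
  have hsx : maxNorm x = σ * x 0 := by rw [maxNorm_eq_of_side hb.le h.le, hev.self_of_nhds]
  have hsd : HasFDerivAt (fun z : Plane => σ * z 0)
      (σ • (EuclideanSpace.proj 0 : Plane →L[ℝ] ℝ)) x :=
    (hasFDerivAt_coord 0 x).const_mul σ
  have hk := (hasDerivAt_dilation (t := σ * x 0)
    (by rw [← hsx]; exact hs.ne')).comp_hasFDerivAt x hsd
  have hy := hk.mul (hasFDerivAt_coord 1 x)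
  set Y := ((fun t : ℝ => (t + 3) / (4 * t)) ∘ fun z : Plane => σ * z 0) x •
    (EuclideanSpace.proj 1 : Plane →L[ℝ] ℝ) + x 1 • (-3 / (4 * (σ * x 0) ^ 2)) •
      (σ • (EuclideanSpace.proj 0 : Plane →L[ℝ] ℝ)) with hY
  have hYe1 : Y (EuclideanSpace.single 1 1) = (maxNorm x + 3) / (4 * maxNorm x) := by
    simp [hY, hsx]
  have hy1 : ∀ᶠ z : Plane in 𝓝 x, mapU1 z 1 = (σ * z 0 + 3) / (4 * (σ * z 0)) * z 1 := by
    filter_upwards [hev'] with z ⟨p, q, r⟩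
    rw [mapU1_apply, maxNorm_eq_of_side p.le q.le, r]
  have hyd : HasFDerivAt (fun z => mapU1 z 1) Y x := hy.congr_of_eventuallyEq hy1
  have hT : HasFDerivAt angle ((2 : ℝ) • Y) x := by
    refine ((hyd.const_mul 2).sub_const 1).congr_of_eventuallyEq ?_
    filter_upwards [hev'] with z ⟨p, q, r⟩
    exact angle_side p.le q.le (by rw [maxNorm_eq_of_side p.le q.le]; exact p.trans q)
  have hrad : ∀ᶠ z : Plane in 𝓝 x, radius z = 3 / 2 + σ / 2 * ((σ * z 0 + 3) / 4)
      - σ / 2 * ((1 - σ * z 0) * max (3 / 4 - mapU1 z 1) 0) := by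
    filter_upwards [hev'] with z ⟨p, q, r⟩
    have hsz : maxNorm z = σ * z 0 := by rw [maxNorm_eq_of_side p.le q.le, r]
    have hs0 : 0 < σ * z 0 := by rw [← r]; exact p.trans q
    have e0 : z 0 / (σ * z 0) = σ := by
      rw [div_eq_iff hs0.ne']; linear_combination (-z 0) * hσ
    have e1 : mapU1 z 0 = σ * ((σ * z 0 + 3) / 4) := by
      rw [mapU1_apply, hsz]
      calc _ = (σ * z 0 + 3) / 4 * (z 0 / (σ * z 0)) := by field_simp
        _ = _ := by rw [e0]; ring
    rw [radius_side p.le q.le (by rw [hsz]; exact hs0), hsz, e0, e1]; ring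
  have hk0 : 0 < (maxNorm x + 3) / (4 * maxNorm x) := by positivity
  have hk1 := dilation_le hs hs1
  have hy0 : 0 ≤ mapU1 x 1 := by rw [mapU1_apply]; positivity
  have h2s : 2 / maxNorm x = 2 * (1 / maxNorm x) := by ring
  have hP : HasFDerivAt (fun z : Plane => 3 / 2 + σ / 2 * ((σ * z 0 + 3) / 4))
      ((σ / 2) • (1 / 4 : ℝ) • σ • (EuclideanSpace.proj 0 : Plane →L[ℝ] ℝ)) x := by
    refine (((((hsd.add_const 3).const_mul (1 / 4)).const_mul (σ / 2)).const_add
      (3 / 2))).congr_of_eventuallyEq (Eventually.of_forall fun z => ?_)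
    ring
  have cy : ContinuousAt (fun z => mapU1 z 1) x := hyd.continuousAt
  rcases lt_or_gt_of_ne h3 with hlt | hgt
  · have hR := hP.sub ((((hsd.const_sub 1).mul (hyd.const_sub (3 / 4)))).const_mul (σ / 2))
    refine ⟨_, _, hR.congr_of_eventuallyEq ?_, hT, ?_⟩
    · filter_upwards [hrad, cy.eventually_lt_const hlt] with z hz hz'
      rw [hz, max_eq_left (by linarith)]; rfl
    · have e : jac ((σ / 2) • (1 / 4 : ℝ) • σ • (EuclideanSpace.proj 0 : Plane →L[ℝ] ℝ)
          - (σ / 2) • ((1 - σ * x 0) • -Y + (3 / 4 - mapU1 x 1) •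
            -(σ • (EuclideanSpace.proj 0 : Plane →L[ℝ] ℝ)))) ((2 : ℝ) • Y)
          = (1 - mapU1 x 1) * ((maxNorm x + 3) / (4 * maxNorm x)) := by
        rw [← hYe1, jac]
        simp
        linear_combination (1 - mapU1 x 1) * Y (EuclideanSpace.single 1 1) * hσ
      rw [e]
      constructor
      · exact mul_pos (by linarith) hk0
      · rw [h2s]
        have : 0 < 1 / maxNorm x := by positivity
        nlinarith
  · refine ⟨_, _, hP.congr_of_eventuallyEq ?_, hT, ?_⟩
    · filter_upwards [hrad, cy.eventually_const_lt hgt] with z hz hz'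
      rw [hz, max_eq_right (by linarith)]; ring
    · have e : jac ((σ / 2) • (1 / 4 : ℝ) • σ • (EuclideanSpace.proj 0 : Plane →L[ℝ] ℝ))
          ((2 : ℝ) • Y) = 1 / 4 * ((maxNorm x + 3) / (4 * maxNorm x)) := by
        rw [← hYe1, jac]
        simp
        linear_combination 1 / 4 * Y (EuclideanSpace.single 1 1) * hσ
      rw [e]
      constructor
      · positivity
      · rw [h2s]
        have : 0 < 1 / maxNorm x := by positivity
        linarith

/-- Radius and angle are differentiable with positive Jacobian in the central sector. -/
theorem exists_jac_top {x : Plane} (hx0 : x 0 ≠ 0) (h : |x 0| < x 1) (hs1 : maxNorm x ≤ 1)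
    (h3 : |mapU1 x 0| ≠ 3 / 4) (z1 : sinkHeight x ≠ -(1 / 4)) (z2 : sinkHeight x ≠ 0)
    (z3 : sinkHeight x ≠ 3 / 4) :
    ∃ R T, HasFDerivAt radius R x ∧ HasFDerivAt angle T x ∧ 0 < jac R T ∧
      jac R T ≤ 2 / maxNorm x := by
  have hb : 0 < x 1 := (abs_nonneg _).trans_lt h
  have hsx : maxNorm x = x 1 := maxNorm_eq_of_top h.le
  have hs : 0 < maxNorm x := by rw [hsx]; exact hb
  obtain ⟨σ, hσ, hev⟩ := exists_sign hx0
  have c0 : Continuous fun z : Plane => z 0 := by fun_prop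
  have c1 : Continuous fun z : Plane => z 1 := by fun_prop
  have hev' : ∀ᶠ z : Plane in 𝓝 x, |z 0| < z 1 ∧ 0 < z 1 ∧ |z 0| = σ * z 0 := by
    filter_upwards [hev, c1.continuousAt.eventually_const_lt hb,
      c0.abs.continuousAt.eventually_lt c1.continuousAt h] with z h1 h2 h3 using ⟨h3, h2, h1⟩
  have hsd := hasFDerivAt_coord 1 x
  have hk := (hasDerivAt_dilation hb.ne').comp_hasFDerivAt x hsd
  have hy := hk.mul (hasFDerivAt_coord 0 x)
  set Y := ((fun t : ℝ => (t + 3) / (4 * t)) ∘ fun z : Plane => z 1) x •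
    (EuclideanSpace.proj 0 : Plane →L[ℝ] ℝ) + x 0 • (-3 / (4 * (x 1) ^ 2)) •
      (EuclideanSpace.proj 1 : Plane →L[ℝ] ℝ) with hY
  have hYe0 : Y (EuclideanSpace.single 0 1) = (maxNorm x + 3) / (4 * maxNorm x) := by
    simp [hY, hsx]
  have hyd : HasFDerivAt (fun z => mapU1 z 0) Y x := by
    refine hy.congr_of_eventuallyEq ?_
    filter_upwards [hev'] with z ⟨p, q, r⟩
    rw [mapU1_apply, maxNorm_eq_of_top p.le]; rfl
  have hk0 : 0 < (maxNorm x + 3) / (4 * maxNorm x) := by positivity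
  have hk1 := dilation_le hs hs1
  have habs : ∀ᶠ z : Plane in 𝓝 x, |mapU1 z 0| = σ * mapU1 z 0 := by
    filter_upwards [hev'] with z ⟨p, q, r⟩
    have : 0 < maxNorm z := by rw [maxNorm_eq_of_top p.le]; exact q
    rw [mapU1_apply, abs_mul, abs_of_pos (by positivity), r]; ring
  obtain ⟨c, d, hc0, hc1, hZ⟩ : ∃ c d : ℝ, 0 < c ∧ c ≤ 7 / 4 ∧
      HasFDerivAt sinkHeight (c • (EuclideanSpace.proj 1 : Plane →L[ℝ] ℝ) + d • Y) x := by
    have cy : ContinuousAt (fun z => |mapU1 z 0|) x := hyd.continuousAt.abs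
    rcases lt_or_gt_of_ne h3 with hlt | hgt
    · refine ⟨(7 - 8 * |mapU1 x 0|) / 4, (1 - x 1) * 2 * σ, by linarith,
        by linarith [abs_nonneg (mapU1 x 0)], ?_⟩
      have := ((((hsd.const_sub 1).const_mul (1 / 4)).mul
        (((hyd.const_mul σ).const_mul 8).const_sub 7))).const_sub 1
      refine (this.congr_of_eventuallyEq ?_).congr_fderiv ?_
      · filter_upwards [hev', habs, cy.eventually_lt_const hlt] with z ⟨p, q, r⟩ hz hz'
        rw [sinkHeight, max_eq_left (by linarith), hz, maxNorm_eq_of_top p.le]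
        simp only [Pi.mul_apply]; ring
      · rw [habs.self_of_nhds]
        ext v
        simp
        ring
    · refine ⟨1 / 4, 0, by norm_num, by norm_num, ?_⟩
      refine (((hsd.const_mul (1 / 4)).const_add (3 / 4)).congr_of_eventuallyEq ?_).congr_fderiv ?_
      · filter_upwards [hev', cy.eventually_const_lt hgt] with z ⟨p, q, r⟩ hz'
        rw [sinkHeight, max_eq_right (by linarith), maxNorm_eq_of_top p.le]
        ring
      · simp
  have hm := (differentiableAt_pinch z1 z2 z3).hasDerivAt.comp_hasFDerivAt x hZ
  have hev0 : ∀ᶠ z : Plane in 𝓝 x, |z 0| ≤ z 1 ∧ 0 < maxNorm z := by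
    filter_upwards [hev'] with z ⟨p, q, r⟩
    exact ⟨p.le, by rw [maxNorm_eq_of_top p.le]; exact q⟩
  refine ⟨_, _, ((hyd.mul hm).const_add (3 / 2)).congr_of_eventuallyEq ?_,
    ((hZ.const_mul 2).sub_const 1).congr_of_eventuallyEq ?_, ?_⟩
  · filter_upwards [hev0] with z hz using radius_top hz.1 hz.2
  · filter_upwards [hev0] with z hz using angle_top hz.1 hz.2
  · have e : jac (mapU1 x 0 • deriv pinch (sinkHeight x) •
          (c • (EuclideanSpace.proj 1 : Plane →L[ℝ] ℝ) + d • Y) + (pinch ∘ sinkHeight) x • Y)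
        ((2 : ℝ) • (c • (EuclideanSpace.proj 1 : Plane →L[ℝ] ℝ) + d • Y))
        = 2 * pinch (sinkHeight x) * c * ((maxNorm x + 3) / (4 * maxNorm x)) := by
      rw [← hYe0, jac]
      simp
      ring
    rw [e]
    have p1 := pinch_pos z2
    have p2 := pinch_le (sinkHeight x)
    constructor
    · positivity
    · have : 2 * pinch (sinkHeight x) * c ≤ 2 := by nlinarith
      calc _ ≤ 2 * (1 / maxNorm x) := by gcongr
        _ = _ := by ring

/-- The pointwise gradient of the composite map. -/
def leakGradient (α : ℝ) (x : Plane) : Matrix (Fin 2) (Fin 2) ℝ :=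
  Matrix.of fun i j => fderiv ℝ (fun z => leakMap α z i) x (EuclideanSpace.single j 1)

theorem leakGradient_apply (α : ℝ) (x : Plane) (i j : Fin 2) : leakGradient α x i j =
    fderiv ℝ (fun z => leakMap α z i) x (EuclideanSpace.single j 1) := rfl

theorem isOpen_rect : IsOpen rect := by
  have h0 : Continuous fun x : Plane => x 0 := by fun_prop
  have h1 : Continuous fun x : Plane => x 1 := by fun_prop
  exact (isOpen_lt continuous_const h0).inter ((isOpen_lt h0 continuous_const).inter
    ((isOpen_lt continuous_const h1).inter (isOpen_lt h1 continuous_const)))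

/-- The Jacobian of polar coordinates is the radius. -/
theorem leakMap_of_jac {α : ℝ} {x : Plane} (hx : x ∈ rect) {R T : Plane →L[ℝ] ℝ}
    (hR : HasFDerivAt radius R x) (hT : HasFDerivAt angle T x) :
    (∀ i, DifferentiableAt ℝ (fun z => leakMap α z i) x) ∧
      (leakGradient α x).det = α * radius x * jac R T := by
  have hev : ∀ᶠ z in 𝓝 x, leakMap α z = mapU4 α !₂[radius z, angle z] := by
    filter_upwards [isOpen_rect.mem_nhds hx] with z hz
    exact leakMap_eq hz.2.2.1.le (maxNorm_pos_of_rect hz)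
  have h0 : HasFDerivAt (fun z => leakMap α z 0) _ x :=
    (hR.mul (hT.const_mul α).cos).congr_of_eventuallyEq
      (hev.mono fun z hz => by simp only [hz]; rfl)
  have h1 : HasFDerivAt (fun z => leakMap α z 1) _ x :=
    (hR.mul (hT.const_mul α).sin).congr_of_eventuallyEq
      (hev.mono fun z hz => by simp only [hz]; rfl)
  constructor
  · intro i
    fin_cases i
    · exact h0.differentiableAt
    · exact h1.differentiableAt
  · rw [Matrix.det_fin_two]
    simp only [leakGradient_apply]
    rw [h0.fderiv, h1.fderiv, jac]
    simp
    linear_combination α * radius x * (R (EuclideanSpace.single 0 1) * T (EuclideanSpace.single 1 1)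
      - R (EuclideanSpace.single 1 1) * T (EuclideanSpace.single 0 1))
      * Real.sin_sq_add_cos_sq (α * angle x)

/-- Almost everywhere in the rectangle the map is differentiable and its Jacobian is positive, with
an integrable singularity at the cavity. -/
theorem ae_leakMap (α : ℝ) (hα : 0 < α) : ∀ᵐ x ∂(volume.restrict rect),
    (∀ i, DifferentiableAt ℝ (fun z => leakMap α z i) x) ∧ 0 < (leakGradient α x).det ∧
      (leakGradient α x).det ≤ 4 * α / maxNorm x := by
  -- In the central sector this is the curve on which `sinkHeight` takes the value `c`.
  have hc (c : ℝ) : ∀ᵐ x : Plane, |x 0| ≠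
      (7 - 4 * (1 - c) / (1 - x 1)) / 8 * (4 * x 1 / (x 1 + 3)) :=
    ae_abs_ne (h := fun b => (7 - 4 * (1 - c) / (1 - b)) / 8 * (4 * b / (b + 3))) (by fun_prop)
  -- The formulas change on the vertical axis, on the diagonals, on the curves `mapU1 x 1 = 3 / 4`
  -- and `|mapU1 x 0| = 3 / 4`, and where `sinkHeight` is `- 1 / 4`, `0` or `3 / 4`.
  filter_upwards [ae_restrict_mem isOpen_rect.measurableSet,
    ae_restrict_of_ae (ae_abs_ne (h := fun _ => 0) (by fun_prop)),
    ae_restrict_of_ae (ae_abs_ne (h := fun b => b) (by fun_prop)),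
    ae_restrict_of_ae (ae_abs_ne (h := fun b => 3 * b / (3 - b)) (by fun_prop)),
    ae_restrict_of_ae (ae_abs_ne (h := fun b => 3 * b / (b + 3)) (by fun_prop)),
    ae_restrict_of_ae (hc (-(1 / 4))), ae_restrict_of_ae (hc 0), ae_restrict_of_ae (hc (3 / 4))]
    with x hx e0 e1 e2 e3 e4 e5 e6
  have hs := maxNorm_pos_of_rect hx
  have hs1 := (puncturedRect_subset (rect_subset hx)).2
  have hb := hx.2.2.1
  have hb1 := hx.2.2.2
  obtain ⟨R, T, hR, hT, hJ, hJ'⟩ : ∃ R T, HasFDerivAt radius R x ∧ HasFDerivAt angle T x ∧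
      0 < jac R T ∧ jac R T ≤ 2 / maxNorm x := by
    rcases lt_or_gt_of_ne e1 with h | h
    · have hsx : maxNorm x = x 1 := maxNorm_eq_of_top h.le
      have hy : |mapU1 x 0| = (x 1 + 3) / (4 * x 1) * |x 0| := by
        rw [mapU1_apply, abs_mul, abs_of_pos (by positivity), hsx]
      have hz (c : ℝ) (hc : c ≤ 3 / 4)
          (hne : |x 0| ≠ (7 - 4 * (1 - c) / (1 - x 1)) / 8 * (4 * x 1 / (x 1 + 3))) :
          sinkHeight x ≠ c := by
        intro hzc
        apply hne
        have h1 : 0 < 1 - x 1 := by linarith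
        have hlt : |mapU1 x 0| < 3 / 4 := by
          by_contra h'
          rw [sinkHeight, max_eq_right (by linarith), hsx] at hzc
          linarith
        rw [sinkHeight, max_eq_left (by linarith), hsx] at hzc
        have h2 : |x 0| = |mapU1 x 0| * (4 * x 1 / (x 1 + 3)) := by rw [hy]; field_simp
        rw [h2]
        congr 1
        rw [← hzc]
        field_simp
        ring
      refine exists_jac_top (fun h0 => e0 (by rw [h0, abs_zero])) h hs1 ?_
        (hz _ (by norm_num) e4) (hz _ (by norm_num) e5) (hz _ le_rfl e6)
      intro h'
      apply e3
      rw [hy] at h'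
      field_simp at h' ⊢
      linarith
    · have hsx : maxNorm x = |x 0| := maxNorm_eq_of_side hb.le h.le
      refine exists_jac_side hb h hs1 ?_
      intro h'
      apply e2
      rw [mapU1_apply, hsx] at h'
      have : 0 < |x 0| := hb.trans h
      have : 0 < 3 - x 1 := by linarith
      field_simp at h' ⊢
      linarith
  obtain ⟨hd, hdet⟩ := leakMap_of_jac (α := α) hx hR hT
  have hr := abs_le.1 (abs_radius_sub_le hb.le hs hs1)
  have hr0 : 0 < radius x := by linarith
  refine ⟨hd, by rw [hdet]; positivity, ?_⟩
  rw [hdet]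
  calc α * radius x * jac R T ≤ α * 2 * (2 / maxNorm x) := by gcongr; linarith
    _ = _ := by ring

/-! ### The boundary of the rectangle -/

theorem IsOuterNormal.unique {Ω : Set Plane} {x ν ν' : Plane} (h : IsOuterNormal Ω x ν)
    (h' : IsOuterNormal Ω x ν') : ν = ν' := by
  by_contra hne
  have n1 : inner ℝ ν ν = (1 : ℝ) := by rw [real_inner_self_eq_norm_sq, h.2.1]; norm_num
  have n2 : inner ℝ ν' ν' = (1 : ℝ) := by rw [real_inner_self_eq_norm_sq, h'.2.1]; norm_num
  have hc : inner ℝ ν' ν = inner ℝ ν ν' := real_inner_comm _ _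
  have hd : 0 < ‖ν - ν'‖ := norm_pos_iff.2 (sub_ne_zero.2 hne)
  have hlt : inner ℝ ν ν' < (1 : ℝ) := by
    have := real_inner_self_eq_norm_sq (ν - ν')
    rw [inner_sub_left, inner_sub_right, inner_sub_right, n1, n2, hc] at this
    nlinarith
  -- The direction `ν - ν'` points out of `Ω` with respect to `ν`, into `Ω` with respect to `ν'`.
  set ε : ℝ := (1 - inner ℝ ν ν') / (2 * ‖ν - ν'‖) with hε
  have hε0 : 0 < ε := div_pos (by linarith) (by positivity)
  have hεn : ε * ‖ν - ν'‖ = (1 - inner ℝ ν ν') / 2 := by rw [hε]; field_simp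
  have ht : Tendsto (fun t : ℝ => x + t • (ν - ν')) (𝓝[>] 0) (𝓝 x) := by
    have : Continuous fun t : ℝ => x + t • (ν - ν') := by fun_prop
    have := this.tendsto 0
    simp only [zero_smul, add_zero] at this
    exact this.mono_left nhdsWithin_le_nhds
  obtain ⟨t, h1, h2, ht0⟩ := ((ht.eventually (h.2.2 ε hε0)).and
    ((ht.eventually (h'.2.2 ε hε0)).and self_mem_nhdsWithin)).exists
  have ht0' : 0 < t := ht0
  rw [add_sub_cancel_left, norm_smul, Real.norm_of_nonneg ht0'.le, inner_smul_left,
    inner_sub_left] at h1 h2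
  simp only [conj_trivial] at h1 h2
  rw [n1, hc] at h1
  rw [n2] at h2
  refine h1.2 ?_ (h2.1 ?_)
  · calc ε * (t * ‖ν - ν'‖) = t * ((1 - inner ℝ ν ν') / 2) := by rw [← hεn]; ring
      _ < _ := by gcongr; linarith
  · calc t * (inner ℝ ν ν' - 1) < t * (-((1 - inner ℝ ν ν') / 2)) := by gcongr; linarith
      _ = _ := by rw [← hεn]; ring

theorem outerNormal_eq {Ω : Set Plane} {x ν : Plane} (h : IsOuterNormal Ω x ν) :
    outerNormal Ω x = ν := by
  have hex : ∃ ν, IsOuterNormal Ω x ν := ⟨ν, h⟩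
  rw [outerNormal, dif_pos hex]
  exact hex.choose_spec.unique h

theorem isOuterNormal_of_halfPlane {Ω : Set Plane} {x ν : Plane} (hx : x ∈ frontier Ω)
    (hν : ‖ν‖ = 1) (h : ∀ᶠ y in 𝓝 x, (y ∈ Ω ↔ inner ℝ (y - x) ν < 0)) : IsOuterNormal Ω x ν := by
  refine ⟨hx, hν, fun ε hε => h.mono fun y hy => ⟨fun hlt => hy.2 ?_, fun hlt hmem => ?_⟩⟩
  · have : 0 ≤ ε * ‖y - x‖ := by positivity
    linarith
  · have : 0 ≤ ε * ‖y - x‖ := by positivity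
    linarith [hy.1 hmem]

theorem closure_rect : closure rect = {x | -1 ≤ x 0 ∧ x 0 ≤ 1 ∧ 0 ≤ x 1 ∧ x 1 ≤ 1} := by
  have c0 : Continuous fun x : Plane => x 0 := by fun_prop
  have c1 : Continuous fun x : Plane => x 1 := by fun_prop
  apply Set.Subset.antisymm
  · refine closure_minimal (fun x hx => ⟨hx.1.le, hx.2.1.le, hx.2.2.1.le, hx.2.2.2.le⟩) ?_
    exact (isClosed_le continuous_const c0).inter ((isClosed_le c0 continuous_const).inter
      ((isClosed_le continuous_const c1).inter (isClosed_le c1 continuous_const)))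
  · intro x hx
    have ht : Tendsto (fun t : ℝ => x + t • ((!₂[0, 1 / 2] : Plane) - x)) (𝓝[>] 0) (𝓝 x) := by
      have : Continuous fun t : ℝ => x + t • (!₂[0, 1 / 2] - x) := by fun_prop
      have := this.tendsto 0
      simp only [zero_smul, add_zero] at this
      exact this.mono_left nhdsWithin_le_nhds
    refine mem_closure_of_tendsto ht ?_
    filter_upwards [Ioo_mem_nhdsGT (zero_lt_one (α := ℝ))] with t ht
    obtain ⟨h1, h2, h3, h4⟩ := hx
    have t0 := ht.1
    have t1 := ht.2
    have e0 : (x + t • ((!₂[0, 1 / 2] : Plane) - x)) 0 = x 0 + t * (0 - x 0) := rfl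
    have e1 : (x + t • ((!₂[0, 1 / 2] : Plane) - x)) 1 = x 1 + t * (1 / 2 - x 1) := rfl
    refine ⟨?_, ?_, ?_, ?_⟩
    · rw [e0]; nlinarith
    · rw [e0]; nlinarith
    · rw [e1]; nlinarith
    · rw [e1]; nlinarith

theorem mem_frontier_rect {x : Plane} : x ∈ frontier rect ↔
    (-1 ≤ x 0 ∧ x 0 ≤ 1 ∧ 0 ≤ x 1 ∧ x 1 ≤ 1) ∧ x ∉ rect := by
  rw [frontier, isOpen_rect.interior_eq, closure_rect]; rfl

theorem isometry_horizontal (c : ℝ) : Isometry fun t : ℝ => (!₂[t, c] : Plane) :=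
  Isometry.of_dist_eq fun s t => by
    rw [EuclideanSpace.dist_eq, Fin.sum_univ_two]
    simp [Real.sqrt_sq_eq_abs, Real.dist_eq]

theorem isometry_vertical (c : ℝ) : Isometry fun t : ℝ => (!₂[c, t] : Plane) :=
  Isometry.of_dist_eq fun s t => by
    rw [EuclideanSpace.dist_eq, Fin.sum_univ_two]
    simp [Real.sqrt_sq_eq_abs, Real.dist_eq]

theorem hausdorffMeasure_restrict_image {γ : ℝ → Plane} (hγ : Isometry γ) (I : Set ℝ)
    (hI : MeasurableSet I) :
    (μH[1] : Measure Plane).restrict (γ '' I) = (volume.restrict I).map γ := by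
  have he := hγ.isClosedEmbedding.measurableEmbedding
  have h := hγ.map_hausdorffMeasure (d := 1) (Or.inl zero_le_one)
  rw [hausdorffMeasure_real] at h
  have h2 : (Measure.map γ volume).restrict (γ '' I) = (volume.restrict I).map γ := by
    rw [he.restrict_map, Set.preimage_image_eq _ hγ.injective]
  rw [← h2, h, Measure.restrict_restrict (he.measurableSet_image.2 hI),
    Set.inter_eq_left.2 (Set.image_subset_range γ I)]

/-- Arc length on the boundary of the rectangle is Lebesgue measure on the four edges. -/
theorem boundaryMeasure_rect : boundaryMeasure rect =
    ((volume.restrict (Set.Ioo (-1) 1)).map fun t : ℝ => (!₂[t, 0] : Plane)) +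
    (((volume.restrict (Set.Ioo (-1) 1)).map fun t : ℝ => (!₂[t, 1] : Plane)) +
    (((volume.restrict (Set.Ioo 0 1)).map fun t : ℝ => (!₂[-1, t] : Plane)) +
    ((volume.restrict (Set.Ioo 0 1)).map fun t : ℝ => (!₂[1, t] : Plane)))) := by
  simp only [← hausdorffMeasure_restrict_image (isometry_horizontal _) _ measurableSet_Ioo,
    ← hausdorffMeasure_restrict_image (isometry_vertical _) _ measurableSet_Ioo]
  have hmh (c : ℝ) (I : Set ℝ) (hI : MeasurableSet I) :
      MeasurableSet ((fun t : ℝ => (!₂[t, c] : Plane)) '' I) :=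
    (isometry_horizontal c).isClosedEmbedding.measurableEmbedding.measurableSet_image.2 hI
  have hmv (c : ℝ) (I : Set ℝ) (hI : MeasurableSet I) :
      MeasurableSet ((fun t : ℝ => (!₂[c, t] : Plane)) '' I) :=
    (isometry_vertical c).isClosedEmbedding.measurableEmbedding.measurableSet_image.2 hI
  have hh (c : ℝ) (I : Set ℝ) (x : Plane) :
      x ∈ (fun t : ℝ => (!₂[t, c] : Plane)) '' I ↔ x 0 ∈ I ∧ x 1 = c := by
    constructor
    · rintro ⟨t, ht, rfl⟩; exact ⟨ht, rfl⟩
    · rintro ⟨h1, h2⟩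
      refine ⟨x 0, h1, ?_⟩
      ext i; fin_cases i
      · rfl
      · exact h2.symm
  have hv (c : ℝ) (I : Set ℝ) (x : Plane) :
      x ∈ (fun t : ℝ => (!₂[c, t] : Plane)) '' I ↔ x 1 ∈ I ∧ x 0 = c := by
    constructor
    · rintro ⟨t, ht, rfl⟩; exact ⟨ht, rfl⟩
    · rintro ⟨h1, h2⟩
      refine ⟨x 1, h1, ?_⟩
      ext i; fin_cases i
      · exact h2.symm
      · rfl
  rw [← Measure.restrict_union _ (hmv 1 _ measurableSet_Ioo),
    ← Measure.restrict_union _ ((hmv (-1) _ measurableSet_Ioo).union (hmv 1 _ measurableSet_Ioo)),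
    ← Measure.restrict_union _ ((hmh 1 _ measurableSet_Ioo).union
      ((hmv (-1) _ measurableSet_Ioo).union (hmv 1 _ measurableSet_Ioo)))]
  · rw [boundaryMeasure]
    refine Measure.restrict_congr_set ?_
    -- The four corners are negligible.
    have hfin : (μH[1] : Measure Plane) {!₂[-1, 0], !₂[-1, 1], !₂[1, 0], !₂[1, 1]} = 0 := by
      have := Measure.nullSingletonClass_hausdorff Plane (d := 1) zero_lt_one
      exact (Set.toFinite _).measure_zero _
    have hcor {a b : ℝ} {x : Plane} (h0 : x 0 = a) (h1 : x 1 = b) : x = !₂[a, b] := by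
      ext i; fin_cases i
      · exact h0
      · exact h1
    refine (ae_iff.2 (measure_mono_null (fun x hx => ?_) hfin))
    by_contra hne
    apply hx
    simp only [Set.mem_insert_iff, Set.mem_singleton_iff, not_or] at hne
    obtain ⟨c1, c2, c3, c4⟩ := hne
    refine propext ?_
    change x ∈ frontier rect ↔ x ∈ (_ ∪ _ : Set Plane)
    simp only [Set.mem_union, hh, hv, mem_frontier_rect, Set.mem_Ioo]
    constructor
    · rintro ⟨⟨h1, h2, h3, h4⟩, h5⟩
      rcases h1.eq_or_lt with h1 | h1
      · rcases h3.eq_or_lt with h3 | h3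
        · exact absurd (hcor h1.symm h3.symm) c1
        rcases h4.eq_or_lt with h4 | h4
        · exact absurd (hcor h1.symm h4) c2
        exact Or.inr (Or.inr (Or.inl ⟨⟨h3, h4⟩, h1.symm⟩))
      rcases h2.eq_or_lt with h2 | h2
      · rcases h3.eq_or_lt with h3 | h3
        · exact absurd (hcor h2 h3.symm) c3
        rcases h4.eq_or_lt with h4 | h4
        · exact absurd (hcor h2 h4) c4
        exact Or.inr (Or.inr (Or.inr ⟨⟨h3, h4⟩, h2⟩))
      rcases h3.eq_or_lt with h3 | h3
      · exact Or.inl ⟨⟨h1, h2⟩, h3.symm⟩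
      rcases h4.eq_or_lt with h4 | h4
      · exact Or.inr (Or.inl ⟨⟨h1, h2⟩, h4⟩)
      exact absurd ⟨h1, h2, h3, h4⟩ h5
    · rintro (⟨⟨h1, h2⟩, h3⟩ | ⟨⟨h1, h2⟩, h3⟩ | ⟨⟨h1, h2⟩, h3⟩ | ⟨⟨h1, h2⟩, h3⟩)
      · exact ⟨⟨h1.le, h2.le, h3.ge, by linarith⟩, fun h => by linarith [h.2.2.1]⟩
      · exact ⟨⟨h1.le, h2.le, by linarith, h3.le⟩, fun h => by linarith [h.2.2.2]⟩
      · exact ⟨⟨h3.ge, by linarith, h1.le, h2.le⟩, fun h => by linarith [h.1]⟩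
      · exact ⟨⟨by linarith, h3.le, h1.le, h2.le⟩, fun h => by linarith [h.2.1]⟩
  all_goals
    rw [Set.disjoint_left]
    intro x hx hx'
    simp only [Set.mem_union, hh, hv, Set.mem_Ioo] at hx hx'
  · rcases hx' with h | h | h
    · linarith [hx.2, h.2]
    · linarith [hx.2, h.1.1]
    · linarith [hx.2, h.1.1]
  · rcases hx' with h | h
    · linarith [hx.2, h.1.2]
    · linarith [hx.2, h.1.2]
  · linarith [hx.2, hx'.2]

theorem outerNormal_bottom {t : ℝ} (ht : t ∈ Set.Ioo (-1 : ℝ) 1) :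
    outerNormal rect !₂[t, 0] = !₂[0, -1] := by
  have c0 : Continuous fun x : Plane => x 0 := by fun_prop
  have c1 : Continuous fun x : Plane => x 1 := by fun_prop
  refine outerNormal_eq (isOuterNormal_of_halfPlane ?_ ?_ ?_)
  · exact mem_frontier_rect.2 ⟨⟨ht.1.le, ht.2.le, le_rfl, zero_le_one⟩,
      fun h => lt_irrefl _ h.2.2.1⟩
  · simp [EuclideanSpace.norm_eq]
  · filter_upwards [c0.continuousAt.eventually_const_lt (show -1 < (!₂[t, 0] : Plane) 0 from ht.1),
      c0.continuousAt.eventually_lt_const (show (!₂[t, 0] : Plane) 0 < 1 from ht.2),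
      c1.continuousAt.eventually_lt_const (show (!₂[t, 0] : Plane) 1 < 1 from zero_lt_one)]
      with y h1 h2 h3
    have : inner ℝ (y - !₂[t, 0]) !₂[0, -1] = -y 1 := by
      simp [PiLp.inner_apply, Fin.sum_univ_two]
    rw [this, neg_lt_zero]
    exact ⟨fun h => h.2.2.1, fun h => ⟨h1, h2, h, h3⟩⟩

theorem outerNormal_top {t : ℝ} (ht : t ∈ Set.Ioo (-1 : ℝ) 1) :
    outerNormal rect !₂[t, 1] = !₂[0, 1] := by
  have c0 : Continuous fun x : Plane => x 0 := by fun_prop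
  have c1 : Continuous fun x : Plane => x 1 := by fun_prop
  refine outerNormal_eq (isOuterNormal_of_halfPlane ?_ ?_ ?_)
  · exact mem_frontier_rect.2 ⟨⟨ht.1.le, ht.2.le, zero_le_one, le_rfl⟩,
      fun h => lt_irrefl _ h.2.2.2⟩
  · simp [EuclideanSpace.norm_eq]
  · filter_upwards [c0.continuousAt.eventually_const_lt (show -1 < (!₂[t, 1] : Plane) 0 from ht.1),
      c0.continuousAt.eventually_lt_const (show (!₂[t, 1] : Plane) 0 < 1 from ht.2),
      c1.continuousAt.eventually_const_lt (show 0 < (!₂[t, 1] : Plane) 1 from zero_lt_one)]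
      with y h1 h2 h3
    have : inner ℝ (y - !₂[t, 1]) !₂[0, 1] = y 1 - 1 := by
      simp [PiLp.inner_apply, Fin.sum_univ_two]
    rw [this, sub_neg]
    exact ⟨fun h => h.2.2.2, fun h => ⟨h1, h2, h3, h⟩⟩

theorem outerNormal_left {t : ℝ} (ht : t ∈ Set.Ioo (0 : ℝ) 1) :
    outerNormal rect !₂[-1, t] = !₂[-1, 0] := by
  have c0 : Continuous fun x : Plane => x 0 := by fun_prop
  have c1 : Continuous fun x : Plane => x 1 := by fun_prop
  refine outerNormal_eq (isOuterNormal_of_halfPlane ?_ ?_ ?_)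
  · exact mem_frontier_rect.2 ⟨⟨le_rfl, show (-1 : ℝ) ≤ 1 by norm_num, ht.1.le, ht.2.le⟩,
      fun h => lt_irrefl _ h.1⟩
  · simp [EuclideanSpace.norm_eq]
  · filter_upwards [c1.continuousAt.eventually_const_lt (show 0 < (!₂[-1, t] : Plane) 1 from ht.1),
      c1.continuousAt.eventually_lt_const (show (!₂[-1, t] : Plane) 1 < 1 from ht.2),
      c0.continuousAt.eventually_lt_const (show (!₂[-1, t] : Plane) 0 < 1 from by norm_num)]
      with y h1 h2 h3
    have : inner ℝ (y - !₂[-1, t]) !₂[-1, 0] = -1 - y 0 := by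
      simp [PiLp.inner_apply, Fin.sum_univ_two]; ring
    rw [this, sub_neg]
    exact ⟨fun h => h.1, fun h => ⟨h, h3, h1, h2⟩⟩

theorem outerNormal_right {t : ℝ} (ht : t ∈ Set.Ioo (0 : ℝ) 1) :
    outerNormal rect !₂[1, t] = !₂[1, 0] := by
  have c0 : Continuous fun x : Plane => x 0 := by fun_prop
  have c1 : Continuous fun x : Plane => x 1 := by fun_prop
  refine outerNormal_eq (isOuterNormal_of_halfPlane ?_ ?_ ?_)
  · exact mem_frontier_rect.2 ⟨⟨show (-1 : ℝ) ≤ 1 by norm_num, le_rfl, ht.1.le, ht.2.le⟩,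
      fun h => lt_irrefl _ h.2.1⟩
  · simp [EuclideanSpace.norm_eq]
  · filter_upwards [c1.continuousAt.eventually_const_lt (show 0 < (!₂[1, t] : Plane) 1 from ht.1),
      c1.continuousAt.eventually_lt_const (show (!₂[1, t] : Plane) 1 < 1 from ht.2),
      c0.continuousAt.eventually_const_lt (show -1 < (!₂[1, t] : Plane) 0 from by norm_num)]
      with y h1 h2 h3
    have : inner ℝ (y - !₂[1, t]) !₂[1, 0] = y 0 - 1 := by
      simp [PiLp.inner_apply, Fin.sum_univ_two]
    rw [this, sub_neg]
    exact ⟨fun h => h.2.1, fun h => ⟨h3, h, h1, h2⟩⟩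

instance : IsFiniteMeasure (boundaryMeasure rect) := by
  rw [boundaryMeasure_rect]; infer_instance

/-- Almost every boundary point lies on an open edge, so a property holds almost everywhere on the
boundary if it does so on each of the four edges. -/
theorem ae_boundaryMeasure_rect {p : Plane → Prop}
    (h1 : ∀ t ∈ Set.Ioo (-1 : ℝ) 1, p !₂[t, 0]) (h2 : ∀ t ∈ Set.Ioo (-1 : ℝ) 1, p !₂[t, 1])
    (h3 : ∀ t ∈ Set.Ioo (0 : ℝ) 1, p !₂[-1, t]) (h4 : ∀ t ∈ Set.Ioo (0 : ℝ) 1, p !₂[1, t]) :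
    ∀ᵐ x ∂(boundaryMeasure rect), p x := by
  have eh (c : ℝ) := (isometry_horizontal c).isClosedEmbedding.measurableEmbedding
  have ev (c : ℝ) := (isometry_vertical c).isClosedEmbedding.measurableEmbedding
  rw [boundaryMeasure_rect, ae_add_measure_iff, ae_add_measure_iff, ae_add_measure_iff,
    (eh 0).ae_map_iff, (eh 1).ae_map_iff, (ev (-1)).ae_map_iff, (ev 1).ae_map_iff]
  exact ⟨(ae_restrict_iff' measurableSet_Ioo).2 (Eventually.of_forall h1),
    (ae_restrict_iff' measurableSet_Ioo).2 (Eventually.of_forall h2),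
    (ae_restrict_iff' measurableSet_Ioo).2 (Eventually.of_forall h3),
    (ae_restrict_iff' measurableSet_Ioo).2 (Eventually.of_forall h4)⟩

theorem integral_boundaryMeasure_rect {f : Plane → ℝ}
    (h1 : IntegrableOn (fun t : ℝ => f !₂[t, 0]) (Set.Ioo (-1) 1))
    (h2 : IntegrableOn (fun t : ℝ => f !₂[t, 1]) (Set.Ioo (-1) 1))
    (h3 : IntegrableOn (fun t : ℝ => f !₂[-1, t]) (Set.Ioo 0 1))
    (h4 : IntegrableOn (fun t : ℝ => f !₂[1, t]) (Set.Ioo 0 1)) :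
    ∫ x, f x ∂(boundaryMeasure rect) =
      (∫ t in Set.Ioo (-1) 1, f !₂[t, 0]) + ((∫ t in Set.Ioo (-1) 1, f !₂[t, 1]) +
      ((∫ t in Set.Ioo 0 1, f !₂[-1, t]) + ∫ t in Set.Ioo 0 1, f !₂[1, t])) := by
  have eh (c : ℝ) := (isometry_horizontal c).isClosedEmbedding.measurableEmbedding
  have ev (c : ℝ) := (isometry_vertical c).isClosedEmbedding.measurableEmbedding
  have i1 := (eh 0).integrable_map_iff.2 h1
  have i2 := (eh 1).integrable_map_iff.2 h2
  have i3 := (ev (-1)).integrable_map_iff.2 h3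
  have i4 := (ev 1).integrable_map_iff.2 h4
  rw [boundaryMeasure_rect,
    integral_add_measure i1 (i2.add_measure (i3.add_measure i4)),
    integral_add_measure i2 (i3.add_measure i4), integral_add_measure i3 i4,
    (eh 0).integral_map, (eh 1).integral_map, (ev (-1)).integral_map, (ev 1).integral_map]

theorem integrableOn_Ioo_of_continuous {f : ℝ → ℝ} (hf : Continuous f) (a b : ℝ) :
    IntegrableOn f (Set.Ioo a b) :=
  (hf.continuousOn.integrableOn_Icc).mono_set Set.Ioo_subset_Icc_self

theorem integral_mul_outerNormal_zero {h : Plane → ℝ} (hh : Continuous h) :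
    ∫ x, h x * outerNormal rect x 0 ∂(boundaryMeasure rect) =
      ∫ t in Set.Ioo (0 : ℝ) 1, (h !₂[1, t] - h !₂[-1, t]) := by
  have i1 : Continuous fun t : ℝ => h !₂[1, t] := hh.comp (isometry_vertical 1).continuous
  have i2 : Continuous fun t : ℝ => h !₂[-1, t] := hh.comp (isometry_vertical (-1)).continuous
  have e1 : ∀ t ∈ Set.Ioo (-1 : ℝ) 1, h !₂[t, 0] * outerNormal rect !₂[t, 0] 0 = 0 := fun t ht => by
    rw [outerNormal_bottom ht]; simp
  have e2 : ∀ t ∈ Set.Ioo (-1 : ℝ) 1, h !₂[t, 1] * outerNormal rect !₂[t, 1] 0 = 0 := fun t ht => by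
    rw [outerNormal_top ht]; simp
  have e3 : ∀ t ∈ Set.Ioo (0 : ℝ) 1, h !₂[-1, t] * outerNormal rect !₂[-1, t] 0 = -h !₂[-1, t] :=
    fun t ht => by rw [outerNormal_left ht]; simp
  have e4 : ∀ t ∈ Set.Ioo (0 : ℝ) 1, h !₂[1, t] * outerNormal rect !₂[1, t] 0 = h !₂[1, t] :=
    fun t ht => by rw [outerNormal_right ht]; simp
  rw [integral_boundaryMeasure_rect, setIntegral_congr_fun measurableSet_Ioo e1,
    setIntegral_congr_fun measurableSet_Ioo e2, setIntegral_congr_fun measurableSet_Ioo e3,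
    setIntegral_congr_fun measurableSet_Ioo e4, integral_sub, integral_neg]
  · simp; ring
  · exact integrableOn_Ioo_of_continuous i1 0 1
  · exact integrableOn_Ioo_of_continuous i2 0 1
  · exact (integrableOn_congr_fun e1 measurableSet_Ioo).2 integrableOn_zero
  · exact (integrableOn_congr_fun e2 measurableSet_Ioo).2 integrableOn_zero
  · exact (integrableOn_congr_fun e3 measurableSet_Ioo).2
      (integrableOn_Ioo_of_continuous i2.neg 0 1)
  · exact (integrableOn_congr_fun e4 measurableSet_Ioo).2 (integrableOn_Ioo_of_continuous i1 0 1)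

theorem integral_mul_outerNormal_one {h : Plane → ℝ} (hh : Continuous h) :
    ∫ x, h x * outerNormal rect x 1 ∂(boundaryMeasure rect) =
      ∫ t in Set.Ioo (-1 : ℝ) 1, (h !₂[t, 1] - h !₂[t, 0]) := by
  have i1 : Continuous fun t : ℝ => h !₂[t, 1] := hh.comp (isometry_horizontal 1).continuous
  have i2 : Continuous fun t : ℝ => h !₂[t, 0] := hh.comp (isometry_horizontal 0).continuous
  have e1 : ∀ t ∈ Set.Ioo (-1 : ℝ) 1, h !₂[t, 0] * outerNormal rect !₂[t, 0] 1 = -h !₂[t, 0] :=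
    fun t ht => by rw [outerNormal_bottom ht]; simp
  have e2 : ∀ t ∈ Set.Ioo (-1 : ℝ) 1, h !₂[t, 1] * outerNormal rect !₂[t, 1] 1 = h !₂[t, 1] :=
    fun t ht => by rw [outerNormal_top ht]; simp
  have e3 : ∀ t ∈ Set.Ioo (0 : ℝ) 1, h !₂[-1, t] * outerNormal rect !₂[-1, t] 1 = 0 :=
    fun t ht => by rw [outerNormal_left ht]; simp
  have e4 : ∀ t ∈ Set.Ioo (0 : ℝ) 1, h !₂[1, t] * outerNormal rect !₂[1, t] 1 = 0 :=
    fun t ht => by rw [outerNormal_right ht]; simp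
  rw [integral_boundaryMeasure_rect, setIntegral_congr_fun measurableSet_Ioo e1,
    setIntegral_congr_fun measurableSet_Ioo e2, setIntegral_congr_fun measurableSet_Ioo e3,
    setIntegral_congr_fun measurableSet_Ioo e4, integral_sub, integral_neg]
  · simp; ring
  · exact integrableOn_Ioo_of_continuous i1 _ _
  · exact integrableOn_Ioo_of_continuous i2 _ _
  · exact (integrableOn_congr_fun e1 measurableSet_Ioo).2
      (integrableOn_Ioo_of_continuous i2.neg _ _)
  · exact (integrableOn_congr_fun e2 measurableSet_Ioo).2 (integrableOn_Ioo_of_continuous i1 _ _)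
  · exact (integrableOn_congr_fun e3 measurableSet_Ioo).2 integrableOn_zero
  · exact (integrableOn_congr_fun e4 measurableSet_Ioo).2 integrableOn_zero

/-- The exterior normal is a unit vector almost everywhere on the boundary. -/
theorem ae_outerNormal_ne_zero :
    ∀ᵐ x ∂(boundaryMeasure rect), outerNormal rect x 0 ≠ 0 ∨ outerNormal rect x 1 ≠ 0 := by
  refine ae_boundaryMeasure_rect (fun t ht => ?_) (fun t ht => ?_) (fun t ht => ?_) fun t ht => ?_
  · rw [outerNormal_bottom ht]; simp
  · rw [outerNormal_top ht]; simp
  · rw [outerNormal_left ht]; simp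
  · rw [outerNormal_right ht]; simp

/-! ### Green's formula and the trace -/

theorem norm_le_abs_add_abs (x : Plane) : ‖x‖ ≤ |x 0| + |x 1| := by
  rw [EuclideanSpace.norm_eq, Fin.sum_univ_two]
  refine Real.sqrt_le_iff.2 ⟨by positivity, ?_⟩
  simp only [Real.norm_eq_abs]
  nlinarith [abs_nonneg (x 0), abs_nonneg (x 1)]

theorem norm_le_two_mul_maxNorm (x : Plane) : ‖x‖ ≤ 2 * maxNorm x := by
  have h0 := abs_apply_le_maxNorm x 0
  have h1 := abs_apply_le_maxNorm x 1
  linarith [norm_le_abs_add_abs x]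

/-- On `rect`, a function bounded by the inverse distance from `0` is `p`-integrable for
`p < 2`. -/
theorem memLp_of_abs_le_div_maxNorm {f : Plane → ℝ} {C : ℝ} {p : ENNReal} (hp : 1 ≤ p)
    (hp2 : p < 2) (hf : AEStronglyMeasurable f (volume.restrict rect))
    (h : ∀ᵐ x ∂(volume.restrict rect), |f x| ≤ C / maxNorm x) :
    MemLp f p (volume.restrict rect) := by
  have hpt : p ≠ ⊤ := hp2.ne_top
  have hp0 : p ≠ 0 := (zero_lt_one.trans_le hp).ne'
  have hr2 : p.toReal < 2 := by
    have := (ENNReal.toReal_lt_toReal hpt ENNReal.ofNat_ne_top).2 hp2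
    simpa using this
  have hr0 : 0 < p.toReal := ENNReal.toReal_pos hp0 hpt
  rw [← integrable_norm_rpow_iff hf hp0 hpt]
  have hdim : Module.finrank ℝ Plane = 2 := by simp
  have hsub : rect ⊆ Metric.ball (0 : Plane) 3 := fun x hx => by
    rw [mem_ball_zero_iff]
    have := (puncturedRect_subset (rect_subset hx)).2
    linarith [norm_le_two_mul_maxNorm x]
  have hmaj : IntegrableOn (fun x : Plane => (2 * |C|) ^ p.toReal * ‖x‖ ^ (-p.toReal)) rect := by
    refine (integrableOn_ball_of_norm_le_rpow (μ := volume) (r := 3) (α := p.toReal)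
      (C := (2 * |C|) ^ p.toReal) ?_ ?_ ?_ ?_).mono_set hsub
    · rw [hdim]; norm_num
    · rw [hdim]; exact_mod_cast hr2
    · refine Eventually.of_forall fun x => ?_
      rw [Real.norm_of_nonneg (by positivity)]
    · exact (Measurable.aestronglyMeasurable (by fun_prop))
  refine hmaj.mono' (hf.norm.aemeasurable.pow_const _).aestronglyMeasurable ?_
  filter_upwards [h, ae_restrict_mem isOpen_rect.measurableSet] with x hx hxr
  have hs := maxNorm_pos_of_rect hxr
  have hn : 0 < ‖x‖ := hs.trans_le (maxNorm_le_norm x)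
  rw [Real.norm_of_nonneg (by positivity), Real.rpow_neg hn.le, ← div_eq_mul_inv,
    ← Real.div_rpow (by positivity) hn.le]
  refine Real.rpow_le_rpow (norm_nonneg _) ?_ hr0.le
  calc ‖f x‖ ≤ C / maxNorm x := hx
    _ ≤ |C| / maxNorm x := by gcongr; exact le_abs_self C
    _ ≤ 2 * |C| / ‖x‖ := by
        rw [div_le_div_iff₀ hs hn]
        nlinarith [norm_le_two_mul_maxNorm x, abs_nonneg C]

theorem exists_norm_leakMap_bound (α : ℝ) : ∃ C, 0 ≤ C ∧ ∀ x ∈ puncturedRect, ‖leakMap α x‖ ≤ C ∧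
    ∀ y ∈ puncturedRect, ‖leakMap α x - leakMap α y‖ ≤ C / maxNorm x * ‖x - y‖ := by
  obtain ⟨C, hC, H⟩ := exists_leakMap_bound α
  refine ⟨C + C, by positivity, fun x hx => ⟨?_, fun y hy => ?_⟩⟩
  · exact (norm_le_abs_add_abs _).trans (add_le_add (H 0 x hx).1 (H 1 x hx).1)
  · refine (norm_le_abs_add_abs _).trans ((add_le_add ((H 0 x hx).2 y hy)
      ((H 1 x hx).2 y hy)).trans_eq ?_)
    ring

theorem continuousOn_leakMap (α : ℝ) : ContinuousOn (leakMap α) rect := by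
  obtain ⟨C, hC, H⟩ := exists_norm_leakMap_bound α
  intro x hx
  refine tendsto_iff_norm_sub_tendsto_zero.2 ?_
  have ht : Tendsto (fun y => C / maxNorm x * ‖x - y‖) (𝓝[rect] x) (𝓝 0) := by
    have : Continuous fun y => C / maxNorm x * ‖x - y‖ := by fun_prop
    have := this.tendsto x
    rw [sub_self, norm_zero, mul_zero] at this
    exact this.mono_left nhdsWithin_le_nhds
  refine squeeze_zero' (Eventually.of_forall fun _ => norm_nonneg _) ?_ ht
  filter_upwards [self_mem_nhdsWithin] with y hy
  rw [norm_sub_rev]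
  exact (H x (rect_subset hx)).2 y (rect_subset hy)

theorem aestronglyMeasurable_leakMap (α : ℝ) :
    AEStronglyMeasurable (leakMap α) (volume.restrict rect) :=
  (continuousOn_leakMap α).aestronglyMeasurable isOpen_rect.measurableSet

theorem volume_rect_lt_top : volume rect < ⊤ := by
  refine (measure_mono (t := Metric.closedBall 0 2) fun x hx => ?_).trans_lt
    measure_closedBall_lt_top
  rw [mem_closedBall_zero_iff]
  have := (puncturedRect_subset (rect_subset hx)).2
  linarith [norm_le_two_mul_maxNorm x]

instance : IsFiniteMeasure (volume.restrict rect) :=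
  isFiniteMeasure_restrict.2 volume_rect_lt_top.ne

theorem memLp_leakMap (α : ℝ) (p : ENNReal) : MemLp (leakMap α) p (volume.restrict rect) := by
  obtain ⟨C, hC, H⟩ := exists_norm_leakMap_bound α
  refine MemLp.of_bound (aestronglyMeasurable_leakMap α) C ?_
  filter_upwards [ae_restrict_mem isOpen_rect.measurableSet] with x hx
  exact (H x (rect_subset hx)).1

theorem exists_leakGradient_bound (α : ℝ) : ∃ C, ∀ i j, ∀ x ∈ rect,
    |leakGradient α x i j| ≤ C / maxNorm x := by
  obtain ⟨C, hC, H⟩ := exists_leakMap_bound α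
  refine ⟨C, fun i j x hx => ?_⟩
  have hs := maxNorm_pos_of_rect hx
  have h1 : ‖fderiv ℝ (fun z => leakMap α z i) x‖ ≤ C / maxNorm x := by
    refine norm_fderiv_le_of_lip' ℝ (by positivity) ?_
    filter_upwards [isOpen_rect.mem_nhds hx] with y hy
    rw [norm_sub_rev, norm_sub_rev y x]
    exact (H i x (rect_subset hx)).2 y (rect_subset hy)
  have h2 := (fderiv ℝ (fun z => leakMap α z i) x).le_opNorm (EuclideanSpace.single j 1)
  rw [PiLp.norm_single, norm_one, mul_one] at h2
  exact h2.trans h1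

theorem measurable_leakGradient (α : ℝ) (i j : Fin 2) :
    Measurable fun x => leakGradient α x i j :=
  measurable_fderiv_apply_const ℝ _ _

theorem memLp_leakGradient (α : ℝ) {p : ENNReal} (hp : 1 ≤ p) (hp2 : p < 2) (i j : Fin 2) :
    MemLp (fun x => leakGradient α x i j) p (volume.restrict rect) := by
  obtain ⟨C, H⟩ := exists_leakGradient_bound α
  refine memLp_of_abs_le_div_maxNorm hp hp2 (measurable_leakGradient α i j).aestronglyMeasurable
    (C := C) ?_
  filter_upwards [ae_restrict_mem isOpen_rect.measurableSet] with x hx using H i j x hx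

/-- The smooth map with the same boundary values as the composite map: it bends the rectangle
diffeomorphically into an annular sector. -/
def bendMap (α : ℝ) (x : Plane) : Plane := mapU4 α !₂[(x 0 + 3) / 2, 2 * x 1 - 1]

theorem continuous_bendMap (α : ℝ) : Continuous (bendMap α) := by
  unfold bendMap mapU4
  simp only [Matrix.cons_val_zero, Matrix.cons_val_one]
  fun_prop

/-- Opening the cavity and closing it again do not displace the boundary. -/
theorem leakMap_eq_bendMap {α : ℝ} {x : Plane} (hx : x ∈ puncturedRect)
    (h : x 1 = 0 ∨ maxNorm x = 1) : leakMap α x = bendMap α x := by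
  obtain ⟨h1, h2, h3, h4, hs⟩ := hx
  rw [leakMap_eq h3 hs, bendMap]
  have key : radius x = (x 0 + 3) / 2 ∧ angle x = 2 * x 1 - 1 := by
    rcases h with h | h
    · have hside : x 1 ≤ |x 0| := by rw [h]; exact abs_nonneg _
      have hy1 : mapU1 x 1 = 0 := by rw [mapU1_apply, h, mul_zero]
      constructor
      · rw [radius_side h3 hside hs, hy1, mapU1_apply, max_eq_left (by norm_num)]
        field_simp
        ring
      · rw [angle_side h3 hside hs, hy1, h]
    · have hy (i : Fin 2) : mapU1 x i = x i := by rw [mapU1_apply, h]; ring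
      constructor
      · rw [radius, sinkHeight, h, sub_self, zero_div, zero_mul, sub_zero,
          pinch_of_ge (by norm_num), hy]
        ring
      · rw [angle, h, hy]; ring
  rw [key.1, key.2]

/-- The fundamental theorem of calculus along a segment that avoids the cavity. -/
theorem integral_leakMap_segment (α : ℝ) {φ : Plane → ℝ} (hφ : ContDiff ℝ 1 φ)
    (hc : HasCompactSupport φ) (i j : Fin 2) {γ : ℝ → Plane} (hγ : Isometry γ)
    (hγd : ∀ t, HasDerivAt γ (EuclideanSpace.single j 1) t) {l r ρ : ℝ} (hlr : l ≤ r) (hρ : 0 < ρ)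
    (hmem : ∀ t ∈ Set.Icc l r, γ t ∈ puncturedRect ∧ ρ ≤ maxNorm (γ t))
    (hd : ∀ᵐ t ∂(volume.restrict (Set.Ioo l r)),
      DifferentiableAt ℝ (fun z => leakMap α z i) (γ t)) :
    ∫ t in Set.Ioo l r,
        (leakMap α (γ t) i * pderiv j φ (γ t) + leakGradient α (γ t) i j * φ (γ t)) =
      leakMap α (γ r) i * φ (γ r) - leakMap α (γ l) i * φ (γ l) := by
  obtain ⟨C, hC, H⟩ := exists_leakMap_bound α
  have hu : LipschitzOnWith ⟨C / ρ, by positivity⟩ (fun t => leakMap α (γ t) i) (Set.uIcc l r) := by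
    rw [Set.uIcc_of_le hlr]
    refine LipschitzOnWith.of_dist_le_mul fun s hs t ht => ?_
    have h1 := (H i _ (hmem s hs).1).2 _ (hmem t ht).1
    rw [← dist_eq_norm, hγ.dist_eq] at h1
    refine h1.trans ?_
    change _ ≤ C / ρ * dist s t
    gcongr
    exact (hmem s hs).2
  obtain ⟨K, hK⟩ := hφ.lipschitzWith_of_hasCompactSupport hc one_ne_zero
  have hφl : LipschitzOnWith (K * 1) (fun t => φ (γ t)) (Set.uIcc l r) :=
    (hK.comp hγ.lipschitz).lipschitzOnWith
  rw [← hu.absolutelyContinuousOnInterval.integral_deriv_mul_eq_sub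
    hφl.absolutelyContinuousOnInterval, intervalIntegral.integral_of_le hlr,
    integral_Ioc_eq_integral_Ioo]
  refine integral_congr_ae ?_
  filter_upwards [hd] with t ht
  have e1 : deriv (fun t => leakMap α (γ t) i) t = leakGradient α (γ t) i j :=
    (ht.hasFDerivAt.comp_hasDerivAt t (hγd t)).deriv
  have e2 : deriv (fun t => φ (γ t)) t = pderiv j φ (γ t) :=
    ((hφ.differentiable one_ne_zero (γ t)).hasFDerivAt.comp_hasDerivAt t (hγd t)).deriv
  rw [e1, e2]; ring

theorem hasDerivAt_horizontal (c t : ℝ) :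
    HasDerivAt (fun t : ℝ => (!₂[t, c] : Plane)) (EuclideanSpace.single 0 1) t := by
  have h := ((hasDerivAt_id t).smul_const (EuclideanSpace.single 0 1 : Plane)).const_add !₂[0, c]
  rw [one_smul] at h
  refine h.congr_of_eventuallyEq (Eventually.of_forall fun s => ?_)
  ext i
  fin_cases i <;> simp

theorem hasDerivAt_vertical (c t : ℝ) :
    HasDerivAt (fun t : ℝ => (!₂[c, t] : Plane)) (EuclideanSpace.single 1 1) t := by
  have h := ((hasDerivAt_id t).smul_const (EuclideanSpace.single 1 1 : Plane)).const_add !₂[c, 0]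
  rw [one_smul] at h
  refine h.congr_of_eventuallyEq (Eventually.of_forall fun s => ?_)
  ext i
  fin_cases i <;> simp

theorem preimage_planeEquiv_rect :
    planeEquiv ⁻¹' rect = Set.Ioo (-1 : ℝ) 1 ×ˢ Set.Ioo (0 : ℝ) 1 := by
  ext p
  simp only [Set.mem_preimage, rect, Set.mem_ofPred_eq, planeEquiv_zero, planeEquiv_one,
    Set.mem_prod, Set.mem_Ioo]
  tauto

theorem measurePreserving_planeEquiv_rect : MeasurePreserving planeEquiv
    ((volume.restrict (Set.Ioo (-1 : ℝ) 1)).prod (volume.restrict (Set.Ioo (0 : ℝ) 1)))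
    (volume.restrict rect) := by
  have := measurePreserving_planeEquiv.restrict_preimage isOpen_rect.measurableSet
  rwa [preimage_planeEquiv_rect, Measure.volume_eq_prod, ← Measure.prod_restrict] at this

theorem integral_rect_eq {F : Plane → ℝ} (hF : IntegrableOn F rect) :
    ∫ x in rect, F x = ∫ a in Set.Ioo (-1 : ℝ) 1, ∫ b in Set.Ioo (0 : ℝ) 1, F !₂[a, b] := by
  rw [← measurePreserving_planeEquiv_rect.integral_comp planeEquiv.measurableEmbedding]
  exact integral_prod _ ((measurePreserving_planeEquiv_rect.integrable_comp_emb
    planeEquiv.measurableEmbedding).2 hF)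

theorem integral_rect_eq_symm {F : Plane → ℝ} (hF : IntegrableOn F rect) :
    ∫ x in rect, F x = ∫ b in Set.Ioo (0 : ℝ) 1, ∫ a in Set.Ioo (-1 : ℝ) 1, F !₂[a, b] := by
  rw [← measurePreserving_planeEquiv_rect.integral_comp planeEquiv.measurableEmbedding]
  exact integral_prod_symm _ ((measurePreserving_planeEquiv_rect.integrable_comp_emb
    planeEquiv.measurableEmbedding).2 hF)

theorem integrable_greenIntegrand (α : ℝ) {φ : Plane → ℝ} (hφ : ContDiff ℝ 1 φ)
    (hc : HasCompactSupport φ) (i j : Fin 2) : IntegrableOn (fun x =>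
      leakMap α x i * pderiv j φ x + leakGradient α x i j * φ x) rect := by
  have hpc : Continuous (pderiv j φ) :=
    (hφ.continuous_fderiv one_ne_zero).clm_apply continuous_const
  have hpb : HasCompactSupport (pderiv j φ) :=
    (hc.fderiv ℝ).comp_left (g := fun L : Plane →L[ℝ] ℝ => L (EuclideanSpace.single j 1)) rfl
  obtain ⟨A, hA⟩ := hpc.bounded_above_of_compact_support hpb
  obtain ⟨B, hB⟩ := hφ.continuous.bounded_above_of_compact_support hc
  have i1 : Integrable (fun x => leakMap α x i) (volume.restrict rect) :=
    memLp_one_iff_integrable.1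
      ((EuclideanSpace.proj i : Plane →L[ℝ] ℝ).comp_memLp' (memLp_leakMap α 1))
  have i2 : Integrable (fun x => leakGradient α x i j) (volume.restrict rect) :=
    memLp_one_iff_integrable.1 (memLp_leakGradient α le_rfl (by norm_num) i j)
  exact (i1.mul_bdd (c := A) hpc.aestronglyMeasurable (Eventually.of_forall hA)).add
    (i2.mul_bdd (c := B) hφ.continuous.aestronglyMeasurable (Eventually.of_forall hB))

/-- Every horizontal line in the rectangle avoids the cavity, so the horizontal component of Green's
formula is the fundamental theorem of calculus on these lines. -/
theorem green_zero {α : ℝ} (hα : 0 < α) {φ : Plane → ℝ} (hφ : ContDiff ℝ 1 φ)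
    (hc : HasCompactSupport φ) (i : Fin 2) :
    ∫ x in rect, (leakMap α x i * pderiv 0 φ x + leakGradient α x i 0 * φ x) =
      ∫ x, bendMap α x i * φ x * outerNormal rect x 0 ∂(boundaryMeasure rect) := by
  have hcont : Continuous fun x => bendMap α x i * φ x :=
    ((EuclideanSpace.proj i : Plane →L[ℝ] ℝ).continuous.comp (continuous_bendMap α)).mul
      hφ.continuous
  rw [integral_mul_outerNormal_zero hcont,
    integral_rect_eq_symm (integrable_greenIntegrand α hφ hc i 0)]
  refine integral_congr_ae ?_
  have hd := measurePreserving_planeEquiv_rect.quasiMeasurePreserving.ae (ae_leakMap α hα)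
  have hd' := Measure.ae_ae_of_ae_prod (Measure.measurePreserving_swap.quasiMeasurePreserving.ae hd)
  filter_upwards [hd', ae_restrict_mem measurableSet_Ioo] with b hb hb'
  have hm : ∀ t ∈ Set.Icc (-1 : ℝ) 1, (!₂[t, b] : Plane) ∈ puncturedRect ∧
      b ≤ maxNorm !₂[t, b] := fun t ht => by
    have hle : b ≤ maxNorm !₂[t, b] := (le_abs_self b).trans (abs_apply_le_maxNorm !₂[t, b] 1)
    exact ⟨⟨ht.1, ht.2, hb'.1.le, hb'.2.le, hb'.1.trans_le hle⟩, hle⟩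
  have h := integral_leakMap_segment α hφ hc i 0 (isometry_horizontal b) (hasDerivAt_horizontal b)
    (show (-1 : ℝ) ≤ 1 by norm_num) hb'.1 hm (hb.mono fun t ht => ht.1 i)
  have hs (t : ℝ) (ht : |t| = 1) : maxNorm !₂[t, b] = 1 := by
    change max |t| |b| = 1
    rw [ht, max_eq_left]
    rw [abs_of_pos hb'.1]; exact hb'.2.le
  refine h.trans ?_
  rw [leakMap_eq_bendMap (hm 1 (by norm_num)).1 (Or.inr (hs 1 (by norm_num))),
    leakMap_eq_bendMap (hm (-1) (by norm_num)).1 (Or.inr (hs (-1) (by norm_num)))]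

/-- Every vertical line but the axis avoids the cavity, so the vertical component of Green's formula
is the fundamental theorem of calculus on these lines. -/
theorem green_one {α : ℝ} (hα : 0 < α) {φ : Plane → ℝ} (hφ : ContDiff ℝ 1 φ)
    (hc : HasCompactSupport φ) (i : Fin 2) :
    ∫ x in rect, (leakMap α x i * pderiv 1 φ x + leakGradient α x i 1 * φ x) =
      ∫ x, bendMap α x i * φ x * outerNormal rect x 1 ∂(boundaryMeasure rect) := by
  have hcont : Continuous fun x => bendMap α x i * φ x :=
    ((EuclideanSpace.proj i : Plane →L[ℝ] ℝ).continuous.comp (continuous_bendMap α)).mul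
      hφ.continuous
  rw [integral_mul_outerNormal_one hcont,
    integral_rect_eq (integrable_greenIntegrand α hφ hc i 1)]
  refine integral_congr_ae ?_
  have hd := Measure.ae_ae_of_ae_prod
    (measurePreserving_planeEquiv_rect.quasiMeasurePreserving.ae (ae_leakMap α hα))
  have hne : ∀ᵐ a : ℝ, a ≠ 0 := by simp [ae_iff, measure_singleton]
  filter_upwards [hd, ae_restrict_mem measurableSet_Ioo, ae_restrict_of_ae hne] with a ha ha' ha0
  have hm : ∀ t ∈ Set.Icc (0 : ℝ) 1, (!₂[a, t] : Plane) ∈ puncturedRect ∧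
      |a| ≤ maxNorm !₂[a, t] := fun t ht => by
    have hle : |a| ≤ maxNorm !₂[a, t] := abs_apply_le_maxNorm !₂[a, t] 0
    exact ⟨⟨ha'.1.le, ha'.2.le, ht.1, ht.2, (abs_pos.2 ha0).trans_le hle⟩, hle⟩
  have h := integral_leakMap_segment α hφ hc i 1 (isometry_vertical a) (hasDerivAt_vertical a)
    zero_le_one (abs_pos.2 ha0) hm (ha.mono fun t ht => ht.1 i)
  have hs : maxNorm !₂[a, 1] = 1 := by
    change max |a| |1| = 1
    rw [abs_one, max_eq_right]
    exact abs_le.2 ⟨ha'.1.le, ha'.2.le⟩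
  refine h.trans ?_
  rw [leakMap_eq_bendMap (hm 1 (by norm_num)).1 (Or.inr hs),
    leakMap_eq_bendMap (hm 0 (by norm_num)).1 (Or.inl rfl)]

theorem green {α : ℝ} (hα : 0 < α) {φ : Plane → ℝ} (hφ : ContDiff ℝ 1 φ)
    (hc : HasCompactSupport φ) (i j : Fin 2) :
    ∫ x in rect, (leakMap α x i * pderiv j φ x + leakGradient α x i j * φ x) =
      ∫ x, bendMap α x i * φ x * outerNormal rect x j ∂(boundaryMeasure rect) := by
  fin_cases j
  · exact green_zero hα hφ hc i
  · exact green_one hα hφ hc i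

theorem isWeakGradient_leakMap {α : ℝ} (hα : 0 < α) :
    IsWeakGradient rect (leakMap α) (leakGradient α) := by
  have i1 : Integrable (leakMap α) (volume.restrict rect) :=
    memLp_one_iff_integrable.1 (memLp_leakMap α 1)
  have i2 (i j) : Integrable (fun x => leakGradient α x i j) (volume.restrict rect) :=
    memLp_one_iff_integrable.1 (memLp_leakGradient α le_rfl (by norm_num) i j)
  refine ⟨IntegrableOn.locallyIntegrableOn i1, fun i j => IntegrableOn.locallyIntegrableOn (i2 i j),
    fun φ hφ hc hsupp i j => ?_⟩
  have hφ1 : ContDiff ℝ 1 φ := hφ.of_le (by exact_mod_cast le_top)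
  have h := green hα hφ1 hc i j
  have h0 : ∫ x, bendMap α x i * φ x * outerNormal rect x j ∂(boundaryMeasure rect) = 0 := by
    refine integral_eq_zero_of_ae ?_
    have hfm : MeasurableSet (frontier rect) := isClosed_frontier.measurableSet
    filter_upwards [ae_restrict_mem (μ := (μH[1] : Measure Plane)) hfm] with x hx
    have : φ x = 0 := by
      by_contra hne
      exact (mem_frontier_rect.1 hx).2 (hsupp (subset_tsupport φ hne))
    simp [this]
  obtain ⟨B, hB⟩ := hφ.continuous.bounded_above_of_compact_support hc
  have j2 : Integrable (fun x => leakGradient α x i j * φ x) (volume.restrict rect) :=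
    (i2 i j).mul_bdd (c := B) hφ.continuous.aestronglyMeasurable (Eventually.of_forall hB)
  have j1 : Integrable (fun x => leakMap α x i * pderiv j φ x) (volume.restrict rect) := by
    have := (integrable_greenIntegrand α hφ1 hc i j).sub j2
    refine this.congr (Eventually.of_forall fun x => ?_)
    simp
  rw [h0, integral_add j1 j2] at h
  linarith

theorem isSobolev_leakMap {α : ℝ} (hα : 0 < α) {p : ENNReal} (hp : 1 ≤ p) (hp2 : p < 2) :
    IsSobolev rect p (leakMap α) (leakGradient α) :=
  ⟨isWeakGradient_leakMap hα, memLp_leakMap α p, memLp_leakGradient α hp hp2⟩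

theorem integrable_bendMap (α : ℝ) : Integrable (bendMap α) (boundaryMeasure rect) := by
  have hb : Bornology.IsBounded rect := by
    refine (Metric.isBounded_closedBall (x := (0 : Plane)) (r := 2)).subset fun x hx => ?_
    rw [mem_closedBall_zero_iff]
    have := (puncturedRect_subset (rect_subset hx)).2
    linarith [norm_le_two_mul_maxNorm x]
  have hK : IsCompact (frontier rect) :=
    hb.isCompact_closure.of_isClosed_subset isClosed_frontier frontier_subset_closure
  obtain ⟨C, hC⟩ := hK.exists_bound_of_continuousOn (continuous_bendMap α).continuousOn
  refine Integrable.of_bound (continuous_bendMap α).aestronglyMeasurable C ?_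
  exact (ae_restrict_mem (μ := (μH[1] : Measure Plane)) isClosed_frontier.measurableSet).mono hC

theorem isTrace_bendMap {α : ℝ} (hα : 0 < α) : IsTrace rect (leakMap α) (bendMap α) :=
  ⟨leakGradient α, isSobolev_leakMap hα le_rfl (by norm_num), integrable_bendMap α,
    fun _ hφ hc i j => green hα hφ hc i j⟩

theorem integrableOn_det_leakGradient {α : ℝ} (hα : 0 < α) :
    IntegrableOn (fun x => (leakGradient α x).det) rect := by
  refine memLp_one_iff_integrable.1 (memLp_of_abs_le_div_maxNorm (C := 4 * α) le_rfl (by norm_num)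
    ?_ ?_)
  · simp only [Matrix.det_fin_two]
    exact (((measurable_leakGradient α 0 0).mul (measurable_leakGradient α 1 1)).sub
      ((measurable_leakGradient α 0 1).mul (measurable_leakGradient α 1 0))).aestronglyMeasurable
  · filter_upwards [ae_leakMap α hα] with x hx
    rw [abs_of_pos hx.2.1]; exact hx.2.2

/-! ### The divergence identities in the interior -/

theorem lineDeriv_eq_zero_of_notMem_tsupport {F : Plane → ℝ} {x : Plane} (hx : x ∉ tsupport F)
    (b : Plane) : lineDeriv ℝ F x b = 0 := by
  have h : F =ᶠ[𝓝 x] fun _ => 0 := by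
    filter_upwards [(isClosed_tsupport F).isOpen_compl.mem_nhds hx] with y hy
      using image_eq_zero_of_notMem_tsupport hy
  have h2 : HasFDerivAt F (0 : Plane →L[ℝ] ℝ) x :=
    (hasFDerivAt_const (0 : ℝ) x).congr_of_eventuallyEq h
  rw [h2.differentiableAt.lineDeriv_eq_fderiv, h2.fderiv]; rfl

theorem integrable_lineDeriv_mul {F v : Plane → ℝ} {C : NNReal} (hF : LipschitzWith C F)
    (hFc : HasCompactSupport F) (hv : Continuous v) (b : Plane) :
    Integrable fun x => lineDeriv ℝ F x b * v x := by
  have h1 : IntegrableOn v (tsupport F) := hv.continuousOn.integrableOn_compact hFc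
  have h2 : IntegrableOn (fun x => lineDeriv ℝ F x b * v x) (tsupport F) :=
    h1.bdd_mul (c := C * ‖b‖)
      (measurable_lineDeriv hF.continuous).aestronglyMeasurable
      (Eventually.of_forall fun x => norm_lineDeriv_le_of_lipschitz ℝ hF)
  exact h2.integrable_of_forall_notMem_eq_zero fun x hx => by
    rw [lineDeriv_eq_zero_of_notMem_tsupport hx, zero_mul]

theorem integrable_lineDeriv_mul_lineDeriv {F v : Plane → ℝ} {C D : NNReal}
    (hF : LipschitzWith C F) (hFc : HasCompactSupport F) (hv : LipschitzWith D v) (a b : Plane) :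
    Integrable fun x => lineDeriv ℝ F x a * lineDeriv ℝ v x b := by
  have h := integrable_lineDeriv_mul hF hFc (continuous_const (y := (1 : ℝ))) a
  simp only [mul_one] at h
  exact h.mul_bdd (c := D * ‖b‖) (measurable_lineDeriv hv.continuous).aestronglyMeasurable
    (Eventually.of_forall fun x => norm_lineDeriv_le_of_lipschitz ℝ hv)

/-- The Jacobian of a pair of Lipschitz functions, one of them with compact support, has integral
zero. Difference quotients in the direction `a` commute with the derivative in the direction `b`, so
that both can be passed from one function to the other. -/
theorem integral_lineDeriv_mul_lineDeriv_comm {F v : Plane → ℝ} {C D : NNReal}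
    (hF : LipschitzWith C F) (hFc : HasCompactSupport F) (hv : LipschitzWith D v) (a b : Plane) :
    ∫ x, lineDeriv ℝ F x a * lineDeriv ℝ v x b = ∫ x, lineDeriv ℝ F x b * lineDeriv ℝ v x a := by
  set K := Metric.cthickening ‖a‖ (tsupport F) with hK
  have hKc : IsCompact K := IsCompact.cthickening hFc
  have hsub : tsupport F ⊆ K := Metric.self_subset_cthickening _
  have hvb : AEStronglyMeasurable (fun x => lineDeriv ℝ v x b) volume :=
    (measurable_lineDeriv hv.continuous).aestronglyMeasurable
  -- The truncation to `K` makes this derivative integrable, and `K` contains the supports of all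
  -- the translates of `F` by at most `a`.
  have hint : Integrable (K.indicator fun x => lineDeriv ℝ v x b) := by
    rw [integrable_indicator_iff hKc.measurableSet]
    exact Measure.integrableOn_of_bounded hKc.measure_lt_top.ne hvb
      (Eventually.of_forall fun x => norm_lineDeriv_le_of_lipschitz ℝ hv)
  have A := hF.integral_inv_smul_sub_mul_tendsto_integral_lineDeriv_mul hint a
  have e1 : ∫ x, lineDeriv ℝ F x a * K.indicator (fun x => lineDeriv ℝ v x b) x =
      ∫ x, lineDeriv ℝ F x a * lineDeriv ℝ v x b := by
    congr 1; ext x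
    by_cases hx : x ∈ K
    · rw [Set.indicator_of_mem hx]
    · rw [lineDeriv_eq_zero_of_notMem_tsupport fun h => hx (hsub h), zero_mul, zero_mul]
  have hFb := integrable_lineDeriv_mul hF hFc (continuous_const (y := (1 : ℝ))) b
  simp only [mul_one] at hFb
  have B := (hv.integral_inv_smul_sub_mul_tendsto_integral_lineDeriv_mul hFb (-a)).neg
  have e2 : -∫ x, lineDeriv ℝ v x (-a) * lineDeriv ℝ F x b =
      ∫ x, lineDeriv ℝ F x b * lineDeriv ℝ v x a := by
    rw [← integral_neg]
    congr 1; ext x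
    rw [lineDeriv_neg]; ring
  rw [e1] at A
  rw [e2] at B
  refine tendsto_nhds_unique A (B.congr' ?_)
  filter_upwards [Ioc_mem_nhdsGT (zero_lt_one (α := ℝ))] with t ht
  -- the translate of `F`
  set G : Plane → ℝ := fun x => F (x + t • a) with hG
  have hGl : LipschitzWith C G := by
    have : LipschitzWith (C * (1 + 0)) G :=
      hF.comp ((LipschitzWith.id (α := Plane)).add (LipschitzWith.const (t • a)))
    simpa only [add_zero, mul_one] using this
  have hGc : HasCompactSupport G := hFc.comp_homeomorph (Homeomorph.addRight (t • a))
  have hGd (x) : lineDeriv ℝ G x b = lineDeriv ℝ F (x + t • a) b := by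
    simp only [lineDeriv, hG]
    congr 1; ext s
    rw [add_right_comm]
  have hGK (x) (hx : x ∉ K) : G x = 0 := by
    by_contra hne
    apply hx
    refine Metric.mem_cthickening_of_dist_le _ (x + t • a) ‖a‖ _ (subset_tsupport _ hne) ?_
    rw [dist_self_add_right, norm_smul, Real.norm_of_nonneg ht.1.le]
    exact mul_le_of_le_one_left (norm_nonneg a) ht.2
  have hFi : Integrable fun x => F x * lineDeriv ℝ v x b :=
    (hF.continuous.integrable_of_hasCompactSupport hFc).mul_bdd (c := D * ‖b‖) hvb
      (Eventually.of_forall fun x => norm_lineDeriv_le_of_lipschitz ℝ hv)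
  have hGi : Integrable fun x => G x * lineDeriv ℝ v x b :=
    (hGl.continuous.integrable_of_hasCompactSupport hGc).mul_bdd (c := D * ‖b‖) hvb
      (Eventually.of_forall fun x => norm_lineDeriv_le_of_lipschitz ℝ hv)
  have ibp {H : Plane → ℝ} (hH : LipschitzWith C H) (hHc : HasCompactSupport H) :
      ∫ x, H x * lineDeriv ℝ v x b = -∫ x, lineDeriv ℝ H x b * v x := by
    have := hv.integral_lineDeriv_mul_eq (μ := volume) hH hHc b
    simp only [lineDeriv_neg, neg_mul, integral_neg] at this
    rw [← this]
    congr 1; ext x; ring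
  have hL : ∫ x, (t⁻¹ • (F (x + t • a) - F x)) * K.indicator (fun x => lineDeriv ℝ v x b) x =
      t⁻¹ * ((∫ x, G x * lineDeriv ℝ v x b) - ∫ x, F x * lineDeriv ℝ v x b) := by
    rw [← integral_sub hGi hFi, ← integral_const_mul]
    congr 1; ext x
    by_cases hx : x ∈ K
    · rw [Set.indicator_of_mem hx, smul_eq_mul]; ring
    · have h1 : F x = 0 := by
        by_contra hne
        exact hx (hsub (subset_tsupport _ hne))
      rw [Set.indicator_of_notMem hx, hGK x hx, h1]; ring
  have htr : ∫ x, lineDeriv ℝ G x b * v x = ∫ x, lineDeriv ℝ F x b * v (x + t • -a) := by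
    simp only [hGd]
    rw [← integral_add_right_eq_self (fun x => lineDeriv ℝ F x b * v (x + t • -a)) (t • a)]
    congr 1; ext x
    congr 2
    module
  have hvt : Continuous fun x => v (x + t • -a) := hv.continuous.comp (by fun_prop)
  rw [hL, ibp hGl hGc, ibp hF hFc, htr]
  have hR : ∫ x, (t⁻¹ • (v (x + t • -a) - v x)) * lineDeriv ℝ F x b =
      t⁻¹ * ((∫ x, lineDeriv ℝ F x b * v (x + t • -a)) - ∫ x, lineDeriv ℝ F x b * v x) := by
    rw [← integral_sub (integrable_lineDeriv_mul hF hFc hvt b)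
      (integrable_lineDeriv_mul hF hFc hv.continuous b), ← integral_const_mul]
    congr 1; ext x
    rw [smul_eq_mul]; ring
  rw [hR]; ring

theorem integral_jacobian_eq_zero {F v : Plane → ℝ} {C D : NNReal}
    (hF : LipschitzWith C F) (hFc : HasCompactSupport F) (hv : LipschitzWith D v) (a b : Plane) :
    (Integrable fun x => lineDeriv ℝ F x a * lineDeriv ℝ v x b
      - lineDeriv ℝ F x b * lineDeriv ℝ v x a) ∧
    ∫ x, (lineDeriv ℝ F x a * lineDeriv ℝ v x b - lineDeriv ℝ F x b * lineDeriv ℝ v x a) = 0 := by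
  have h1 := integrable_lineDeriv_mul_lineDeriv hF hFc hv a b
  have h2 := integrable_lineDeriv_mul_lineDeriv hF hFc hv b a
  exact ⟨h1.sub h2, by
    rw [integral_sub h1 h2, integral_lineDeriv_mul_lineDeriv_comm hF hFc hv, sub_self]⟩

theorem lipschitzWith_mul_of_bounded {f g : Plane → ℝ} {C D A B : NNReal} (hf : LipschitzWith C f)
    (hg : LipschitzWith D g) (hfb : ∀ x, ‖f x‖ ≤ A) (hgb : ∀ x, ‖g x‖ ≤ B) :
    LipschitzWith (C * B + A * D) fun x => f x * g x := by
  refine LipschitzWith.of_dist_le_mul fun x y => ?_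
  have h1 := hf.dist_le_mul x y
  have h2 := hg.dist_le_mul x y
  rw [Real.dist_eq] at h1 h2 ⊢
  calc |f x * g x - f y * g y| = |(f x - f y) * g x + f y * (g x - g y)| := by ring_nf
    _ ≤ |f x - f y| * |g x| + |f y| * |g x - g y| := by
        rw [← abs_mul, ← abs_mul]; exact abs_add_le _ _
    _ ≤ C * dist x y * B + A * (D * dist x y) := by
        gcongr
        · exact hgb x
        · exact hfb y
    _ = _ := by push_cast; ring

theorem mk_eq (a b : ℝ) : (!₂[a, b] : Plane) =
    a • EuclideanSpace.single 0 1 + b • EuclideanSpace.single 1 1 := by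
  ext i; fin_cases i <;> simp

/-- The divergence identities hold in the interior, since the map is Lipschitz on the support of any
test function: their integrand is then a sum of Jacobians of pairs of Lipschitz functions. -/
theorem divergenceFunctional_leakMap {α : ℝ} (hα : 0 < α) {φ : Plane → ℝ} {g : Plane → Plane}
    (hφ : ContDiff ℝ 1 φ) (hφc : HasCompactSupport φ) (hφs : tsupport φ ⊆ rect)
    (hg : ContDiff ℝ 1 g) (hgc : HasCompactSupport g) :
    divergenceFunctional rect (leakMap α) (leakGradient α) φ g = 0 := by
  have c1 : Continuous fun x : Plane => x 1 := by fun_prop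
  obtain ⟨ρ, hρ0, hρ⟩ := IsCompact.exists_forall_le' (a := 0) hφc c1.continuousOn
    fun x hx => (hφs hx).2.2.1
  -- The support of `φ` keeps a distance from the bottom edge, hence from the cavity. The map is
  -- Lipschitz on the neighbourhood `V` of it, and `v` is a Lipschitz extension to the plane.
  set V : Set Plane := rect ∩ {x | ρ / 2 < x 1} with hV
  have hVo : IsOpen V := isOpen_rect.inter (isOpen_lt continuous_const c1)
  have hφV : tsupport φ ⊆ V := fun x hx => ⟨hφs hx, by
    have := hρ x hx
    change ρ / 2 < x 1
    linarith⟩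
  obtain ⟨C, hC, H⟩ := exists_leakMap_bound α
  obtain ⟨M, hlip⟩ : ∃ M : NNReal, ∀ i : Fin 2, LipschitzOnWith M (fun x => leakMap α x i) V := by
    refine ⟨⟨C / (ρ / 2), by positivity⟩, fun i => ?_⟩
    refine LipschitzOnWith.of_dist_le_mul fun x hx y hy => ?_
    refine ((H i x (rect_subset hx.1)).2 y (rect_subset hy.1)).trans ?_
    rw [← dist_eq_norm]
    change _ ≤ C / (ρ / 2) * dist x y
    have h1 : ρ / 2 ≤ maxNorm x := (le_of_lt hx.2).trans
      ((le_abs_self _).trans (abs_apply_le_maxNorm x 1))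
    gcongr
  choose v hv hvV using fun i => (hlip i).extend_real
  obtain ⟨A, hA⟩ := hφ.continuous.bounded_above_of_compact_support hφc
  obtain ⟨K, hK⟩ := hφ.lipschitzWith_of_hasCompactSupport hφc one_ne_zero
  obtain ⟨B, hB⟩ := hg.continuous.bounded_above_of_compact_support hgc
  obtain ⟨L, hL⟩ := hg.lipschitzWith_of_hasCompactSupport hgc one_ne_zero
  set w : Plane → Plane := fun x => !₂[v 0 x, v 1 x] with hw
  set F : Fin 2 → Plane → ℝ := fun i x => φ x * g (w x) i with hF
  have hk (i : Fin 2) : LipschitzWith (L * (M + M)) fun x => g (w x) i := by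
    refine LipschitzWith.of_dist_le_mul fun x y => ?_
    have h0 := (hv 0).dist_le_mul x y
    have h1 := (hv 1).dist_le_mul x y
    calc dist (g (w x) i) (g (w y) i) ≤ dist (g (w x)) (g (w y)) := by
          rw [dist_eq_norm, dist_eq_norm]
          exact PiLp.norm_apply_le (g (w x) - g (w y)) i
      _ ≤ L * dist (w x) (w y) := hL.dist_le_mul _ _
      _ ≤ L * (dist (v 0 x) (v 0 y) + dist (v 1 x) (v 1 y)) := by
          gcongr
          rw [dist_eq_norm]
          exact norm_le_abs_add_abs _
      _ ≤ L * (M * dist x y + M * dist x y) := by gcongr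
      _ = _ := by push_cast; ring
  have hFl (i : Fin 2) : LipschitzWith _ (F i) := lipschitzWith_mul_of_bounded hK (hk i)
    (A := ⟨|A|, abs_nonneg A⟩) (B := ⟨|B|, abs_nonneg B⟩)
    (fun x => (hA x).trans (le_abs_self A))
    (fun x => ((PiLp.norm_apply_le (g (w x)) i).trans (hB _)).trans (le_abs_self B))
  have hFs (i : Fin 2) : tsupport (F i) ⊆ tsupport φ :=
    closure_mono (Function.support_mul_subset_left φ _)
  have hFc (i : Fin 2) : HasCompactSupport (F i) := hφc.mul_right
  set e : Fin 2 → Plane := fun j => EuclideanSpace.single j 1 with he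
  -- the integrand, written as a sum of two Jacobians
  set Q : Plane → ℝ := fun x =>
    (lineDeriv ℝ (F 0) x (e 0) * lineDeriv ℝ (v 1) x (e 1)
      - lineDeriv ℝ (F 0) x (e 1) * lineDeriv ℝ (v 1) x (e 0))
    - (lineDeriv ℝ (F 1) x (e 0) * lineDeriv ℝ (v 0) x (e 1)
      - lineDeriv ℝ (F 1) x (e 1) * lineDeriv ℝ (v 0) x (e 0)) with hQ
  have hQ0 : ∫ x, Q x = 0 := by
    obtain ⟨i0, z0⟩ := integral_jacobian_eq_zero (hFl 0) (hFc 0) (hv 1) (e 0) (e 1)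
    obtain ⟨i1, z1⟩ := integral_jacobian_eq_zero (hFl 1) (hFc 1) (hv 0) (e 0) (e 1)
    rw [hQ, integral_sub i0 i1, z0, z1, sub_zero]
  have hQr : ∫ x in rect, Q x = 0 := by
    rw [setIntegral_eq_integral_of_forall_compl_eq_zero, hQ0]
    intro x hx
    have h (i : Fin 2) (b : Plane) : lineDeriv ℝ (F i) x b = 0 :=
      lineDeriv_eq_zero_of_notMem_tsupport (fun h => hx (hφs (hFs i h))) b
    simp only [hQ, h]; ring
  rw [← hQr, divergenceFunctional]
  refine integral_congr_ae ?_
  filter_upwards [ae_leakMap α hα] with x hx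
  by_cases hxs : x ∈ tsupport φ
  · have hD (i : Fin 2) : HasFDerivAt (v i) (fderiv ℝ (fun z => leakMap α z i) x) x := by
      refine (hx.1 i).hasFDerivAt.congr_of_eventuallyEq ?_
      filter_upwards [hVo.mem_nhds (hφV hxs)] with z hz using (hvV i hz).symm
    have hwx : w x = leakMap α x := by
      ext i
      fin_cases i
      · exact (hvV 0 (hφV hxs)).symm
      · exact (hvV 1 (hφV hxs)).symm
    have hwD : HasFDerivAt w _ x :=
      (((hD 0).smul_const (e 0)).add ((hD 1).smul_const (e 1))).congr_of_eventuallyEq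
        (Eventually.of_forall fun z => mk_eq _ _)
    have hgi (i : Fin 2) : HasFDerivAt (fun y => g y i) (fderiv ℝ (fun y => g y i) (w x)) (w x) :=
      ((EuclideanSpace.proj i : Plane →L[ℝ] ℝ).differentiableAt.comp (w x)
        (hg.differentiable one_ne_zero (w x))).hasFDerivAt
    have hFD (i : Fin 2) : HasFDerivAt (F i) _ x :=
      ((hφ.differentiable one_ne_zero x).hasFDerivAt).mul ((hgi i).comp x hwD)
    simp only [hQ, (hFD _).differentiableAt.lineDeriv_eq_fderiv,
      (hD _).differentiableAt.lineDeriv_eq_fderiv, (hFD _).fderiv, (hD _).fderiv]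
    simp only [hwx, Matrix.adjugate_fin_two, Matrix.det_fin_two, Fin.sum_univ_two, divergence,
      pderiv, leakGradient_apply, Matrix.mulVec, dotProduct]
    simp [he]
    ring
  · have h (i : Fin 2) (b : Plane) : lineDeriv ℝ (F i) x b = 0 :=
      lineDeriv_eq_zero_of_notMem_tsupport (fun h => hxs (hFs i h)) b
    have h2 (j : Fin 2) : pderiv j φ x = 0 := by
      rw [pderiv, ← (hφ.differentiable one_ne_zero x).lineDeriv_eq_fderiv]
      exact lineDeriv_eq_zero_of_notMem_tsupport hxs _
    simp only [hQ, h, h2, image_eq_zero_of_notMem_tsupport hxs]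
    simp

theorem leakMap_mem_classA {α : ℝ} (hα : 0 < α) {p : ENNReal} (hp : 1 ≤ p) (hp2 : p < 2) :
    leakMap α ∈ ClassA rect p :=
  ⟨leakGradient α, isSobolev_leakMap hα hp hp2, integrableOn_det_leakGradient hα,
    fun _ _ hφ hφc hφs hg hgc => divergenceFunctional_leakMap hα hφ hφc hφs hg hgc⟩

/-! ### Uniqueness of the weak gradient and of the trace -/

theorem IsWeakGradient.ae_eq {Ω : Set Plane} (hΩ : IsOpen Ω) {u : Plane → Plane}
    {D D' : Plane → Matrix (Fin 2) (Fin 2) ℝ} (h : IsWeakGradient Ω u D)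
    (h' : IsWeakGradient Ω u D') (hi : ∀ i j, IntegrableOn (fun x => D x i j) Ω)
    (hi' : ∀ i j, IntegrableOn (fun x => D' x i j) Ω) :
    ∀ᵐ x ∂(volume.restrict Ω), D x = D' x := by
  have key (i j : Fin 2) : ∀ᵐ x ∂(volume.restrict Ω), D x i j = D' x i j := by
    rw [ae_restrict_iff' hΩ.measurableSet]
    have := hΩ.ae_eq_zero_of_integral_contDiff_smul_eq_zero (μ := volume)
      (f := fun x => D x i j - D' x i j) ((hi i j).sub (hi' i j)).locallyIntegrableOn
      (fun φ hφ hc hs => ?_)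
    · filter_upwards [this] with x hx hxΩ using sub_eq_zero.1 (hx hxΩ)
    · obtain ⟨B, hB⟩ := hφ.continuous.bounded_above_of_compact_support hc
      have i1 := (hi i j).mul_bdd (c := B) hφ.continuous.aestronglyMeasurable
        (Eventually.of_forall hB)
      have i2 := (hi' i j).mul_bdd (c := B) hφ.continuous.aestronglyMeasurable
        (Eventually.of_forall hB)
      rw [← setIntegral_eq_integral_of_forall_compl_eq_zero (s := Ω)]
      · have e1 := h.2.2 φ hφ hc hs i j
        rw [h'.2.2 φ hφ hc hs i j] at e1
        have e2 := integral_sub i1 i2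
        rw [neg_inj.1 e1, sub_self] at e2
        rw [← e2]
        congr 1; ext x
        rw [smul_eq_mul]; ring
      · intro x hx
        rw [image_eq_zero_of_notMem_tsupport fun hx' => hx (hs hx'), zero_smul]
  filter_upwards [key 0 0, key 0 1, key 1 0, key 1 1] with x h1 h2 h3 h4
  ext i j
  fin_cases i <;> fin_cases j <;> assumption

theorem IsSobolev.integrableOn {p : ENNReal} (hp : 1 ≤ p) {u : Plane → Plane}
    {D : Plane → Matrix (Fin 2) (Fin 2) ℝ} (h : IsSobolev rect p u D) (i j : Fin 2) :
    IntegrableOn (fun x => D x i j) rect :=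
  (h.2.2 i j).integrable hp

theorem aestronglyMeasurable_outerNormal (j : Fin 2) :
    AEStronglyMeasurable (fun x => outerNormal rect x j) (boundaryMeasure rect) := by
  have hm {k : Fin 2} (c : ℝ) : MeasurableSet {x : Plane | x k = c} :=
    measurableSet_eq_fun (by fun_prop) measurable_const
  fin_cases j
  · have h : Measurable fun x : Plane => if x 0 = 1 then (1 : ℝ) else if x 0 = -1 then -1 else 0 :=
      Measurable.ite (hm 1) measurable_const (Measurable.ite (hm (-1)) measurable_const
        measurable_const)
    refine h.aestronglyMeasurable.congr (ae_boundaryMeasure_rect (fun t ht => ?_) (fun t ht => ?_)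
      (fun t ht => ?_) fun t ht => ?_)
    · simp [outerNormal_bottom ht, ht.1.ne', ht.2.ne]
    · simp [outerNormal_top ht, ht.1.ne', ht.2.ne]
    · simp [outerNormal_left ht]; norm_num
    · simp [outerNormal_right ht]
  · have h : Measurable fun x : Plane => if x 1 = 1 then (1 : ℝ) else if x 1 = 0 then -1 else 0 :=
      Measurable.ite (hm 1) measurable_const (Measurable.ite (hm 0) measurable_const
        measurable_const)
    refine h.aestronglyMeasurable.congr (ae_boundaryMeasure_rect (fun t ht => ?_) (fun t ht => ?_)
      (fun t ht => ?_) fun t ht => ?_)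
    · simp [outerNormal_bottom ht]
    · simp [outerNormal_top ht]
    · simp [outerNormal_left ht, ht.1.ne', ht.2.ne]
    · simp [outerNormal_right ht, ht.1.ne', ht.2.ne]

theorem ae_abs_outerNormal_le (j : Fin 2) :
    ∀ᵐ x ∂(boundaryMeasure rect), ‖outerNormal rect x j‖ ≤ 1 := by
  refine ae_boundaryMeasure_rect (fun t ht => ?_) (fun t ht => ?_) (fun t ht => ?_) fun t ht => ?_
  · rw [outerNormal_bottom ht]; fin_cases j <;> simp
  · rw [outerNormal_top ht]; fin_cases j <;> simp
  · rw [outerNormal_left ht]; fin_cases j <;> simp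
  · rw [outerNormal_right ht]; fin_cases j <;> simp

theorem IsTrace.ae_eq {u w w' : Plane → Plane} (h : IsTrace rect u w) (h' : IsTrace rect u w') :
    ∀ᵐ x ∂(boundaryMeasure rect), w x = w' x := by
  obtain ⟨D, hD, hw, H⟩ := h
  obtain ⟨D', hD', hw', H'⟩ := h'
  have hDD := hD.1.ae_eq isOpen_rect hD'.1 (hD.integrableOn le_rfl) (hD'.integrableOn le_rfl)
  have hcomp {w : Plane → Plane} (hw : Integrable w (boundaryMeasure rect)) (i j : Fin 2) :
      Integrable (fun x => w x i * outerNormal rect x j) (boundaryMeasure rect) :=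
    (memLp_one_iff_integrable.1 ((EuclideanSpace.proj i : Plane →L[ℝ] ℝ).comp_memLp'
      (memLp_one_iff_integrable.2 hw))).mul_bdd (c := 1) (aestronglyMeasurable_outerNormal j)
      (ae_abs_outerNormal_le j)
  have key (i j : Fin 2) : ∀ᵐ x ∂(boundaryMeasure rect),
      w x i * outerNormal rect x j - w' x i * outerNormal rect x j = 0 := by
    refine ae_eq_zero_of_integral_contDiff_smul_eq_zero
      ((hcomp hw i j).sub (hcomp hw' i j)).locallyIntegrable fun φ hφ hc => ?_
    have hφ1 : ContDiff ℝ 1 φ := hφ.of_le (by exact_mod_cast le_top)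
    obtain ⟨B, hB⟩ := hφ.continuous.bounded_above_of_compact_support hc
    have i1 := (hcomp hw i j).mul_bdd (c := B) hφ.continuous.aestronglyMeasurable
      (Eventually.of_forall hB)
    have i2 := (hcomp hw' i j).mul_bdd (c := B) hφ.continuous.aestronglyMeasurable
      (Eventually.of_forall hB)
    have e : ∫ x, w x i * φ x * outerNormal rect x j ∂(boundaryMeasure rect) =
        ∫ x, w' x i * φ x * outerNormal rect x j ∂(boundaryMeasure rect) := by
      rw [← H φ hφ1 hc i j, ← H' φ hφ1 hc i j]
      refine integral_congr_ae ?_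
      filter_upwards [hDD] with x hx
      rw [hx]
    have e2 := integral_sub i1 i2
    have e3 : ∀ w : Plane → Plane, (fun x => w x i * outerNormal rect x j * φ x) =
        fun x => w x i * φ x * outerNormal rect x j := fun w => by ext x; ring
    rw [e3 w, e3 w', e, sub_self] at e2
    rw [← e2]
    congr 1; ext x
    rw [smul_eq_mul]; ring
  filter_upwards [key 0 0, key 0 1, key 1 0, key 1 1, ae_outerNormal_ne_zero] with x h1 h2 h3 h4 hn
  rw [← sub_mul] at h1 h2 h3 h4
  ext i
  fin_cases i
  · rcases hn with hn | hn
    · exact sub_eq_zero.1 ((mul_eq_zero.1 h1).resolve_right hn)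
    · exact sub_eq_zero.1 ((mul_eq_zero.1 h2).resolve_right hn)
  · rcases hn with hn | hn
    · exact sub_eq_zero.1 ((mul_eq_zero.1 h3).resolve_right hn)
    · exact sub_eq_zero.1 ((mul_eq_zero.1 h4).resolve_right hn)

/-! ### The divergence identities up to the boundary fail -/

/-- The square of the positive part, a cut-off function of class `C¹`. -/
def sqPos (t : ℝ) : ℝ := max 0 t ^ 2

theorem hasDerivAt_sqPos (t : ℝ) : HasDerivAt sqPos (2 * max 0 t) t := by
  rcases lt_trichotomy t 0 with h | h | h
  · rw [max_eq_left h.le, mul_zero]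
    refine (hasDerivAt_const t (0 : ℝ)).congr_of_eventuallyEq ?_
    filter_upwards [Iio_mem_nhds h] with s hs
    rw [sqPos, max_eq_left (le_of_lt hs)]; ring
  · subst h
    have : sqPos =O[𝓝 0] fun s : ℝ => ‖s - 0‖ ^ 2 := by
      refine Asymptotics.IsBigO.of_bound 1 (Eventually.of_forall fun s => ?_)
      rw [sub_zero, one_mul, Real.norm_of_nonneg (by unfold sqPos; positivity),
        Real.norm_of_nonneg (by positivity), sqPos, Real.norm_eq_abs]
      gcongr
      exact max_le (abs_nonneg s) (le_abs_self s)
    simpa using (this.hasFDerivAt one_lt_two).hasDerivAt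
  · rw [max_eq_right h.le]
    have := hasDerivAt_pow 2 t
    refine HasDerivAt.congr_of_eventuallyEq (f := fun s : ℝ => s ^ 2) (by simpa using this) ?_
    filter_upwards [Ioi_mem_nhds h] with s hs
    rw [sqPos, max_eq_right (le_of_lt hs)]

theorem contDiff_sqPos : ContDiff ℝ 1 sqPos := by
  rw [contDiff_one_iff_deriv]
  refine ⟨fun t => (hasDerivAt_sqPos t).differentiableAt, ?_⟩
  have : deriv sqPos = fun t => 2 * max 0 t := funext fun t => (hasDerivAt_sqPos t).deriv
  rw [this]
  fun_prop

/-- A horizontal vector field supported near the negative horizontal axis, in the sector that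
`bendMap α` leaves free: it lives on `-2 < y₁ < -3/2`, `|y₂| < sin α`, and its length decreases in
`y₁` for `y₁ ≥ -7/4`. Leaked material has radius less than `7/4`, so it only meets that part. -/
def gapField (α : ℝ) (y : Plane) : Plane :=
  !₂[sqPos (1 / 16 - (y 0 + 7 / 4) ^ 2) * sqPos (Real.sin α ^ 2 - y 1 ^ 2), 0]

theorem gapField_zero (α : ℝ) (y : Plane) : gapField α y 0 =
    sqPos (1 / 16 - (y 0 + 7 / 4) ^ 2) * sqPos (Real.sin α ^ 2 - y 1 ^ 2) := rfl

theorem contDiff_gapField (α : ℝ) : ContDiff ℝ 1 (gapField α) := by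
  rw [contDiff_euclidean]
  intro i
  have h0 : ContDiff ℝ 1 fun y : Plane => y 0 := (EuclideanSpace.proj 0 : Plane →L[ℝ] ℝ).contDiff
  have h1 : ContDiff ℝ 1 fun y : Plane => y 1 := (EuclideanSpace.proj 1 : Plane →L[ℝ] ℝ).contDiff
  fin_cases i
  · exact (contDiff_sqPos.comp (contDiff_const.sub ((h0.add contDiff_const).pow 2))).mul
      (contDiff_sqPos.comp (contDiff_const.sub (h1.pow 2)))
  · exact contDiff_const

theorem sqPos_of_nonpos {t : ℝ} (h : t ≤ 0) : sqPos t = 0 := by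
  rw [sqPos, max_eq_left h]; ring

theorem gapField_eq_zero {α : ℝ} {y : Plane}
    (h : 1 / 16 - (y 0 + 7 / 4) ^ 2 ≤ 0 ∨ Real.sin α ^ 2 - y 1 ^ 2 ≤ 0) : gapField α y = 0 := by
  ext i
  fin_cases i
  · change gapField α y 0 = 0
    rw [gapField_zero]
    rcases h with h | h
    · rw [sqPos_of_nonpos h, zero_mul]
    · rw [sqPos_of_nonpos h, mul_zero]
  · rfl

theorem hasCompactSupport_gapField (α : ℝ) : HasCompactSupport (gapField α) := by
  refine HasCompactSupport.intro (isCompact_closedBall (0 : Plane) 3) fun y hy => ?_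
  rw [mem_closedBall_zero_iff, not_le] at hy
  apply gapField_eq_zero
  by_contra! h
  have h0 : |y 0| ≤ 2 := by rw [abs_le]; constructor <;> nlinarith
  have h1 : |y 1| ≤ 1 := by
    rw [← sq_le_one_iff_abs_le_one]
    linarith [Real.sin_sq_le_one α]
  linarith [norm_le_abs_add_abs y]

theorem divergence_gapField (α : ℝ) (y : Plane) : divergence (gapField α) y =
    -4 * (y 0 + 7 / 4) * max 0 (1 / 16 - (y 0 + 7 / 4) ^ 2) * sqPos (Real.sin α ^ 2 - y 1 ^ 2) := by
  have h0 : HasFDerivAt (fun z : Plane => 1 / 16 - (z 0 + 7 / 4) ^ 2) _ y :=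
    (((hasFDerivAt_coord 0 y).add_const (7 / 4)).pow 2).const_sub (1 / 16)
  have h1 : HasFDerivAt (fun z : Plane => Real.sin α ^ 2 - z 1 ^ 2) _ y :=
    ((hasFDerivAt_coord 1 y).pow 2).const_sub (Real.sin α ^ 2)
  have hA : HasFDerivAt (fun z => gapField α z 0) _ y :=
    ((hasDerivAt_sqPos _).comp_hasFDerivAt y h0).mul ((hasDerivAt_sqPos _).comp_hasFDerivAt y h1)
  have hB : HasFDerivAt (fun z => gapField α z 1) (0 : Plane →L[ℝ] ℝ) y := hasFDerivAt_const 0 y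
  rw [divergence, Fin.sum_univ_two, pderiv, pderiv, hA.fderiv, hB.fderiv]
  simp
  ring

theorem sin_le_abs_sin {α θ : ℝ} (h1 : α < Real.pi) (h2 : |θ| ≤ α)
    (hc : Real.cos θ < 0) : Real.sin α ≤ |Real.sin θ| := by
  have hp : Real.pi / 2 < |θ| := by
    by_contra! h
    have := Real.cos_nonneg_of_mem_Icc (x := θ)
      ⟨by linarith [neg_abs_le θ], (le_abs_self θ).trans h⟩
    linarith
  have habs : |Real.sin θ| = Real.sin |θ| := by
    have h0 := Real.sin_nonneg_of_nonneg_of_le_pi (abs_nonneg θ) (by linarith)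
    rcases abs_cases θ with ⟨h, -⟩ | ⟨h, -⟩
    · rw [h] at h0 ⊢; exact abs_of_nonneg h0
    · rw [h] at h0 ⊢
      rw [Real.sin_neg] at h0 ⊢
      exact abs_of_nonpos (by linarith)
  rw [habs, ← Real.sin_pi_sub α, ← Real.sin_pi_sub |θ|]
  exact Real.sin_le_sin_of_le_of_le_pi_div_two (by linarith) (by linarith) (by linarith)

/-- Annular sectors of opening `2 α` do not meet the support of `gapField α`. -/
theorem gap_of_abs_angle_le {α R T : ℝ} (hα : 0 < α) (hα' : α < Real.pi) (hR : 1 ≤ R)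
    (hT : |T| ≤ 1) :
    1 / 16 - (R * Real.cos (α * T) + 7 / 4) ^ 2 ≤ 0 ∨
      Real.sin α ^ 2 - (R * Real.sin (α * T)) ^ 2 ≤ 0 := by
  have hsin := Real.sin_pos_of_pos_of_lt_pi hα hα'
  rcases le_or_gt 0 (Real.cos (α * T)) with h | h
  · left
    have : 0 ≤ R * Real.cos (α * T) := by positivity
    nlinarith
  · right
    have h1 : |α * T| ≤ α := by
      rw [abs_mul, abs_of_pos hα]; nlinarith
    have h2 := sin_le_abs_sin hα' h1 h
    rw [sub_nonpos, ← sq_abs (R * _), abs_mul, abs_of_pos (by linarith)]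
    gcongr
    nlinarith

theorem angle_le_one {x : Plane} (hs : 0 < maxNorm x) (hs1 : maxNorm x ≤ 1) : angle x ≤ 1 := by
  have h1 := (abs_le.1 (abs_mapU1_le_one hs hs1 1)).2
  have h2 : 0 ≤ 2 * (1 - maxNorm x) * max (3 / 4 - |mapU1 x 0|) 0 :=
    mul_nonneg (by linarith) (le_max_right _ _)
  rw [angle]; linarith

theorem leakMap_zero {α : ℝ} {x : Plane} (hx : x ∈ rect) :
    leakMap α x 0 = radius x * Real.cos (α * angle x) := by
  rw [leakMap_eq hx.2.2.1.le (maxNorm_pos_of_rect hx)]; rfl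

theorem leakMap_one {α : ℝ} {x : Plane} (hx : x ∈ rect) :
    leakMap α x 1 = radius x * Real.sin (α * angle x) := by
  rw [leakMap_eq hx.2.2.1.le (maxNorm_pos_of_rect hx)]; rfl

/-- Only leaked material reaches the support of `gapField α`, and there the first coordinate is in
the range in which the field decreases. -/
theorem divergence_gapField_leakMap_nonpos {α : ℝ} (hα : 0 < α) (hα' : α < Real.pi) {x : Plane}
    (hx : x ∈ rect) : divergence (gapField α) (leakMap α x) ≤ 0 := by
  have hs := maxNorm_pos_of_rect hx
  have hs1 := (puncturedRect_subset (rect_subset hx)).2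
  have hr := abs_le.1 (abs_radius_sub_le hx.2.2.1.le hs hs1)
  rw [divergence_gapField, leakMap_zero hx, leakMap_one hx]
  have hB : 0 ≤ sqPos (Real.sin α ^ 2 - (radius x * Real.sin (α * angle x)) ^ 2) := by
    unfold sqPos; positivity
  have hA : 0 ≤ max 0 (1 / 16 - (radius x * Real.cos (α * angle x) + 7 / 4) ^ 2) := le_max_left _ _
  rcases lt_or_ge (angle x) (-1) with h | h
  · have h1 := abs_lt.1 (abs_radius_sub_lt_of_angle_lt hx.2.2.1.le hs h)
    have h2 : 0 ≤ radius x * Real.cos (α * angle x) + 7 / 4 := by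
      nlinarith [Real.neg_one_le_cos (α * angle x)]
    have := mul_nonneg (mul_nonneg h2 hA) hB
    linarith
  · rcases gap_of_abs_angle_le hα hα' (R := radius x) (by linarith)
        (abs_le.2 ⟨h, angle_le_one hs hs1⟩) with h' | h'
    · rw [max_eq_left h']; simp
    · rw [sqPos_of_nonpos h']; simp

/-- Some leaked material does reach the support of `gapField α`. -/
theorem exists_divergence_gapField_neg {α : ℝ} (hα : 4 * Real.pi / 5 < α) (hα' : α < Real.pi) :
    ∃ x ∈ rect, divergence (gapField α) (leakMap α x) < 0 := by
  have hpi := Real.pi_pos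
  have hα0 : 0 < α := by linarith
  have hq1 : 1 < Real.pi / α := by rw [lt_div_iff₀ hα0]; linarith
  have hq2 : Real.pi / α < 5 / 4 := by rw [div_lt_iff₀ hα0]; linarith
  -- `s` is the height at which the line `mapU1 x 0 = 1 / 8` reaches the angle `- π`.
  set s : ℝ := 1 - (1 + Real.pi / α) / 3 with hs
  have hs1 : 1 / 4 < s := by rw [hs]; linarith
  have hs2 : s < 1 / 3 := by rw [hs]; linarith
  set x : Plane := !₂[s / (2 * (s + 3)), s] with hx
  have x0 : x 0 = s / (2 * (s + 3)) := rfl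
  have x1 : x 1 = s := rfl
  have hx0 : 0 < x 0 := by rw [x0]; positivity
  have hle : x 0 < x 1 := by
    rw [x0, x1, div_lt_iff₀ (by positivity)]; nlinarith
  have habs : |x 0| ≤ x 1 := by rw [abs_of_pos hx0]; exact hle.le
  have hxr : x ∈ rect := ⟨by linarith, by linarith, by linarith, by linarith⟩
  have hm : maxNorm x = s := maxNorm_eq_of_top habs
  have hm0 := maxNorm_pos_of_rect hxr
  have hy : mapU1 x 0 = 1 / 8 := by
    rw [mapU1_apply, hm, x0]
    have : s ≠ 0 := by linarith
    have : s + 3 ≠ 0 := by linarith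
    field_simp
    norm_num
  have hz : sinkHeight x = (1 - Real.pi / α) / 2 := by
    rw [sinkHeight, hy, hm, max_eq_left (by rw [abs_of_pos] <;> norm_num),
      abs_of_pos (by norm_num), hs]
    ring
  have hT : α * angle x = -Real.pi := by
    rw [angle_top habs hm0, hz]
    field_simp
    ring
  have hR := radius_top habs hm0
  rw [hy] at hR
  have p1 := pinch_pos (t := sinkHeight x) (by rw [hz]; linarith)
  have p2 := pinch_le (sinkHeight x)
  refine ⟨x, hxr, ?_⟩
  rw [divergence_gapField, leakMap_zero hxr, leakMap_one hxr, hT, Real.cos_neg, Real.cos_pi,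
    Real.sin_neg, Real.sin_pi]
  have h1 : 0 < radius x * -1 + 7 / 4 := by linarith
  have h2 : 0 < 1 / 16 - (radius x * -1 + 7 / 4) ^ 2 := by nlinarith
  have h3 : 0 < Real.sin α ^ 2 - (radius x * -0) ^ 2 := by
    have := Real.sin_pos_of_pos_of_lt_pi hα0 hα'
    rw [neg_zero, mul_zero]
    nlinarith
  rw [max_eq_right h2.le, sqPos, max_eq_right h3.le]
  have := mul_pos (mul_pos h1 h2) (pow_pos h3 2)
  linarith

theorem continuous_divergence {g : Plane → Plane} (hg : ContDiff ℝ 1 g) :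
    Continuous (divergence g) := by
  have hg' := contDiff_euclidean.1 hg
  refine continuous_finsetSum _ fun i _ => ?_
  exact ((hg' i).continuous_fderiv one_ne_zero).clm_apply continuous_const

theorem integral_det_mul_divergence_neg {α : ℝ} (hα : 4 * Real.pi / 5 < α) (hα' : α < Real.pi) :
    ∫ x in rect, (leakGradient α x).det * divergence (gapField α) (leakMap α x) < 0 := by
  have hα0 : 0 < α := by linarith [Real.pi_pos]
  have hcont := continuous_divergence (contDiff_gapField α)
  have hcs : HasCompactSupport (divergence (gapField α)) := by
    refine HasCompactSupport.intro (hasCompactSupport_gapField α) fun y hy => ?_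
    have hev : gapField α =ᶠ[𝓝 y] fun _ => 0 := by
      filter_upwards [(isClosed_tsupport (gapField α)).isOpen_compl.mem_nhds hy] with z hz
        using image_eq_zero_of_notMem_tsupport hz
    refine Finset.sum_eq_zero fun i _ => ?_
    have : (fun z => gapField α z i) =ᶠ[𝓝 y] fun _ => 0 :=
      hev.mono fun z hz => by simp only [hz]; rfl
    rw [pderiv, this.fderiv_eq]; simp
  obtain ⟨B, hB⟩ := hcont.bounded_above_of_compact_support hcs
  have hint : IntegrableOn (fun x => (leakGradient α x).det *
      divergence (gapField α) (leakMap α x)) rect :=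
    (integrableOn_det_leakGradient hα0).mul_bdd (c := B)
      (hcont.comp_aestronglyMeasurable (aestronglyMeasurable_leakMap α))
      (Eventually.of_forall fun x => hB _)
  obtain ⟨x₀, hx₀, hneg⟩ := exists_divergence_gapField_neg hα hα'
  have hopen : IsOpen (rect ∩ (fun x => divergence (gapField α) (leakMap α x)) ⁻¹' Set.Iio 0) :=
    (hcont.comp_continuousOn (continuousOn_leakMap α)).isOpen_inter_preimage isOpen_rect isOpen_Iio
  have hpos := hopen.measure_pos volume ⟨x₀, hx₀, hneg⟩
  have hae := ae_leakMap α hα0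
  have key : 0 < ∫ x in rect, -((leakGradient α x).det *
      divergence (gapField α) (leakMap α x)) := by
    refine (integral_pos_iff_support_of_nonneg_ae ?_ hint.neg).2 ?_
    · filter_upwards [hae, ae_restrict_mem isOpen_rect.measurableSet] with x hx hxr
      have := divergence_gapField_leakMap_nonpos hα0 hα' hxr
      have := mul_nonpos_of_nonneg_of_nonpos hx.2.1.le this
      simpa using this
    · have h1 : volume.restrict rect
          (rect ∩ (fun x => divergence (gapField α) (leakMap α x)) ⁻¹' Set.Iio 0) ≤
          volume.restrict rect (Function.support fun x => -((leakGradient α x).det *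
            divergence (gapField α) (leakMap α x))) := by
        refine measure_mono_ae ?_
        filter_upwards [hae] with x hx hxm
        have : divergence (gapField α) (leakMap α x) < 0 := hxm.2
        exact neg_ne_zero.2 (mul_ne_zero hx.2.1.ne' this.ne)
      rw [Measure.restrict_apply hopen.measurableSet, Set.inter_right_comm, Set.inter_self] at h1
      exact hpos.trans_le h1
  rw [integral_neg] at key
  linarith

theorem leakMap_notMem_classABar {α : ℝ} (hα : 4 * Real.pi / 5 < α) (hα' : α < Real.pi)
    {p : ENNReal} (hp : 1 ≤ p) : leakMap α ∉ ClassABar rect p := by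
  have hα0 : 0 < α := by linarith [Real.pi_pos]
  rintro ⟨Du, w, v, hDu, hw, -, -, H⟩
  have hD := hDu.1.ae_eq isOpen_rect (isWeakGradient_leakMap hα0) (hDu.integrableOn hp)
    ((isSobolev_leakMap hα0 le_rfl (by norm_num)).integrableOn le_rfl)
  have hw' := hw.ae_eq (isTrace_bendMap hα0)
  -- The constant `1` is admissible in the identity up to the boundary.
  have h := H (fun _ => 1) (gapField α) contDiff_const (contDiff_gapField α)
    (hasCompactSupport_gapField α)
  -- The trace does not meet the support of the field.
  have hR : boundaryFunctional rect w v (fun _ => 1) (gapField α) = 0 := by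
    refine integral_eq_zero_of_ae ?_
    filter_upwards [hw', ae_restrict_mem (μ := (μH[1] : Measure Plane))
      isClosed_frontier.measurableSet] with x hx hxf
    obtain ⟨⟨h1, h2, h3, h4⟩, -⟩ := mem_frontier_rect.1 hxf
    have hg : gapField α (w x) = 0 := by
      rw [hx]
      exact gapField_eq_zero (gap_of_abs_angle_le (R := (x 0 + 3) / 2) (T := 2 * x 1 - 1) hα0 hα'
        (by linarith) (abs_le.2 ⟨by linarith, by linarith⟩))
    simp [hg]
  have hL : divergenceFunctional rect (leakMap α) Du (fun _ => 1) (gapField α) =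
      ∫ x in rect, (leakGradient α x).det * divergence (gapField α) (leakMap α x) := by
    refine integral_congr_ae ?_
    filter_upwards [hD] with x hx
    simp [hx, pderiv]
  have := integral_det_mul_divergence_neg hα hα'
  rw [← hL, h, hR] at this
  exact lt_irrefl _ this

/-! ### The boundary diffeomorphism -/

theorem contDiffAt_polarCoord {q : ℝ × ℝ} (hq : q ∈ polarCoord.source) :
    ContDiffAt ℝ ∞ polarCoord q := by
  have hp := polarCoord.map_source hq
  have hdet : (fderivPolarCoordSymm (polarCoord q)).det ≠ 0 := by
    rw [det_fderivPolarCoordSymm]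
    exact (ne_of_gt hp.1)
  refine polarCoord.symm.contDiffAt_symm hq
    (f₀' := (fderivPolarCoordSymm (polarCoord q)).toContinuousLinearEquivOfDetNeZero hdet) ?_ ?_
  · exact hasFDerivAt_polarCoord_symm _
  · have : ContDiff ℝ ∞ fun p : ℝ × ℝ => (p.1 * Real.cos p.2, p.1 * Real.sin p.2) := by fun_prop
    exact this.contDiffAt

/-- The affine change of variables from the plane to radius and angle. -/
def stripHomeomorph {α : ℝ} (hα : α ≠ 0) : Plane ≃ₜ ℝ × ℝ where
  toFun x := ((x 0 + 3) / 2, α * (2 * x 1 - 1))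
  invFun p := !₂[2 * p.1 - 3, (p.2 / α + 1) / 2]
  left_inv x := by
    ext i
    fin_cases i
    · simp; ring
    · simp; field_simp; ring
  right_inv p := by
    ext
    · simp
    · simp; field_simp; ring
  continuous_toFun := by fun_prop
  continuous_invFun := by fun_prop

/-- The identification of `ℝ × ℝ` with the plane as a homeomorphism. -/
def planeHomeomorph : ℝ × ℝ ≃ₜ Plane where
  toFun p := !₂[p.1, p.2]
  invFun x := (x 0, x 1)
  left_inv p := rfl
  right_inv x := by ext i; fin_cases i <;> rfl
  continuous_toFun := by fun_prop
  continuous_invFun := by fun_prop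

/-- `bendMap α` on the half strip on which it is injective. -/
def bendHomeomorph {α : ℝ} (hα : α ≠ 0) : OpenPartialHomeomorph Plane Plane :=
  (stripHomeomorph hα).toOpenPartialHomeomorph.trans
    (polarCoord.symm.trans planeHomeomorph.toOpenPartialHomeomorph)

theorem mem_bendHomeomorph_source {α : ℝ} (hα : α ≠ 0) {x : Plane} :
    x ∈ (bendHomeomorph hα).source ↔
      0 < (x 0 + 3) / 2 ∧ -Real.pi < α * (2 * x 1 - 1) ∧ α * (2 * x 1 - 1) < Real.pi := by
  simp [bendHomeomorph, stripHomeomorph]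

theorem closure_rect_subset_source {α : ℝ} (hα : 0 < α) (hα' : α < Real.pi) :
    closure rect ⊆ (bendHomeomorph hα.ne').source := by
  rw [closure_rect]
  rintro x ⟨h1, h2, h3, h4⟩
  rw [mem_bendHomeomorph_source]
  exact ⟨by linarith, by nlinarith, by nlinarith⟩

theorem contDiff_mk {f g : Plane → ℝ} (hf : ContDiff ℝ ∞ f) (hg : ContDiff ℝ ∞ g) :
    ContDiff ℝ ∞ fun x => (!₂[f x, g x] : Plane) := by
  rw [contDiff_euclidean]
  intro i
  fin_cases i
  · exact hf
  · exact hg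

theorem contDiff_bendMap (α : ℝ) : ContDiff ℝ ∞ (bendMap α) := by
  have h0 : ContDiff ℝ ∞ fun y : Plane => y 0 := (EuclideanSpace.proj 0 : Plane →L[ℝ] ℝ).contDiff
  have h1 : ContDiff ℝ ∞ fun y : Plane => y 1 := (EuclideanSpace.proj 1 : Plane →L[ℝ] ℝ).contDiff
  have h2 : ContDiff ℝ ∞ fun y : Plane => α * (2 * y 1 - 1) :=
    contDiff_const.mul ((contDiff_const.mul h1).sub contDiff_const)
  have h3 : ContDiff ℝ ∞ fun y : Plane => (y 0 + 3) / 2 := (h0.add contDiff_const).div_const 2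
  exact contDiff_mk (h3.mul h2.cos) (h3.mul h2.sin)

theorem contDiffOn_bendHomeomorph_symm {α : ℝ} (hα : α ≠ 0) :
    ContDiffOn ℝ ∞ (bendHomeomorph hα).symm (bendHomeomorph hα).target := by
  intro y hy
  have hy' : ((y 0, y 1) : ℝ × ℝ) ∈ polarCoord.source := by
    simp only [bendHomeomorph, OpenPartialHomeomorph.trans_target,
      Homeomorph.toOpenPartialHomeomorph_target, OpenPartialHomeomorph.symm_target] at hy
    exact hy.1.2
  have h0 : ContDiff ℝ ∞ fun y : Plane => y 0 := (EuclideanSpace.proj 0 : Plane →L[ℝ] ℝ).contDiff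
  have h1 : ContDiff ℝ ∞ fun y : Plane => y 1 := (EuclideanSpace.proj 1 : Plane →L[ℝ] ℝ).contDiff
  have hp : ContDiffAt ℝ ∞ (fun y : Plane => polarCoord (y 0, y 1)) y :=
    (contDiffAt_polarCoord hy').comp y (h0.prodMk h1).contDiffAt
  have hs : ContDiff ℝ ∞ fun p : ℝ × ℝ => (!₂[2 * p.1 - 3, (p.2 / α + 1) / 2] : Plane) := by
    rw [contDiff_euclidean]
    intro i
    fin_cases i
    · exact (contDiff_const.mul contDiff_fst).sub contDiff_const
    · exact ((contDiff_snd.div_const α).add contDiff_const).div_const 2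
  exact (hs.contDiffAt.comp y hp).contDiffWithinAt

theorem isAIB_leakMap {α : ℝ} (hα : 0 < α) (hα' : α < Real.pi) : IsAIB rect (leakMap α) := by
  refine ⟨bendMap α, isTrace_bendMap hα, (continuous_bendMap α).continuousOn, fun _ => bendMap α,
    fun _ => ⟨(continuous_bendMap α).continuousOn, ?_⟩, ?_⟩
  · exact (bendHomeomorph hα.ne').injOn.mono
      (frontier_subset_closure.trans (closure_rect_subset_source hα hα'))
  · exact fun _ hu => Eventually.of_forall fun _ _ _ => refl_mem_uniformity hu

/-! ### Failure of injectivity -/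

/-- In the coordinates `mapU1 x 0`, `x 1` of the central sector, the vertical shear that changes the
height `sinkHeight` by `c / 4`. -/
def sinkShear (c : ℝ) (x : Plane) : Plane :=
  !₂[(x 1 + 3) / (4 * x 1) * x 0 *
      (4 * (x 1 + c / (7 - 8 * ((x 1 + 3) / (4 * x 1) * x 0)))) /
      (x 1 + c / (7 - 8 * ((x 1 + 3) / (4 * x 1) * x 0)) + 3),
    x 1 + c / (7 - 8 * ((x 1 + 3) / (4 * x 1) * x 0))]

theorem sinkShear_one (c : ℝ) (x : Plane) :
    sinkShear c x 1 = x 1 + c / (7 - 8 * ((x 1 + 3) / (4 * x 1) * x 0)) := rfl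

theorem sinkShear_zero (c : ℝ) (x : Plane) : sinkShear c x 0 =
    (x 1 + 3) / (4 * x 1) * x 0 * (4 * sinkShear c x 1) / (sinkShear c x 1 + 3) := rfl

theorem dilation_sinkShear {c : ℝ} {x : Plane} (h : 0 < sinkShear c x 1) :
    (sinkShear c x 1 + 3) / (4 * sinkShear c x 1) * sinkShear c x 0 =
      (x 1 + 3) / (4 * x 1) * x 0 := by
  rw [sinkShear_zero]
  have : sinkShear c x 1 + 3 ≠ 0 := by positivity
  field_simp

theorem sinkShear_neg_sinkShear {c : ℝ} {x : Plane} (h : 0 < sinkShear c x 1) (hx : 0 < x 1) :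
    sinkShear (-c) (sinkShear c x) = x := by
  have h1 : sinkShear (-c) (sinkShear c x) 1 = x 1 := by
    rw [sinkShear_one, dilation_sinkShear h, sinkShear_one]; ring
  ext i
  fin_cases i
  · change sinkShear (-c) (sinkShear c x) 0 = x 0
    rw [sinkShear_zero, h1, dilation_sinkShear h]
    have : x 1 + 3 ≠ 0 := by positivity
    field_simp
  · exact h1

theorem differentiableAt_sinkShear {c : ℝ} {x : Plane} (hx : 0 < x 1)
    (hy : (x 1 + 3) / (4 * x 1) * x 0 < 3 / 4) (h : 0 < sinkShear c x 1) :
    DifferentiableAt ℝ (sinkShear c) x := by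
  have d0 : DifferentiableAt ℝ (fun z : Plane => z 0) x := (hasFDerivAt_coord 0 x).differentiableAt
  have d1 : DifferentiableAt ℝ (fun z : Plane => z 1) x := (hasFDerivAt_coord 1 x).differentiableAt
  have h4 : 4 * x 1 ≠ 0 := by positivity
  have h7 : 7 - 8 * ((x 1 + 3) / (4 * x 1) * x 0) ≠ 0 := by linarith
  have h3 : sinkShear c x 1 + 3 ≠ 0 := by positivity
  have dy : DifferentiableAt ℝ (fun z : Plane => (z 1 + 3) / (4 * z 1) * z 0) x := by
    simp only [div_eq_mul_inv]
    exact ((d1.add_const 3).mul ((d1.const_mul 4).inv h4)).mul d0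
  have ds : DifferentiableAt ℝ (fun z : Plane => sinkShear c z 1) x := by
    simp only [sinkShear_one, div_eq_mul_inv c]
    exact d1.add ((((dy.const_mul 8).const_sub 7).inv h7).const_mul c)
  rw [differentiableAt_euclidean]
  intro i
  fin_cases i
  · change DifferentiableAt ℝ (fun z : Plane => sinkShear c z 0) x
    simp only [sinkShear_zero, div_eq_mul_inv _ (sinkShear c _ 1 + 3)]
    exact (dy.mul (ds.const_mul 4)).mul ((ds.add_const 3).inv h3)
  · exact ds

/-- The leaked material overlaps with the rest, one full turn later. -/
theorem leakMap_sinkShear {α : ℝ} (hα : 0 < α) {x : Plane} (hx0 : 0 < x 0) (hx1 : 0 < x 1)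
    (hle : x 0 < x 1) (hx : x 1 < 1) (hy : (x 1 + 3) / (4 * x 1) * x 0 < 3 / 4)
    (hz : 1 - (1 - x 1) / 4 * (7 - 8 * ((x 1 + 3) / (4 * x 1) * x 0)) < -(1 / 4))
    (h1 : sinkShear (4 * Real.pi / α) x 1 < 1)
    (hz' : 3 / 4 < 1 - (1 - x 1) / 4 * (7 - 8 * ((x 1 + 3) / (4 * x 1) * x 0)) + Real.pi / α) :
    sinkShear (4 * Real.pi / α) x ∈ rect ∧ x 1 < sinkShear (4 * Real.pi / α) x 1 ∧
      leakMap α (sinkShear (4 * Real.pi / α) x) = leakMap α x := by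
  set y := (x 1 + 3) / (4 * x 1) * x 0 with hydef
  set x' := sinkShear (4 * Real.pi / α) x with hx'
  have hy0 : 0 < y := by positivity
  have h7 : 0 < 7 - 8 * y := by linarith
  have hpi := Real.pi_pos
  have hs : x' 1 = x 1 + 4 * Real.pi / α / (7 - 8 * y) := sinkShear_one _ _
  have hlt : x 1 < x' 1 := by
    rw [hs]
    have : 0 < 4 * Real.pi / α / (7 - 8 * y) := by positivity
    linarith
  have hx'1 : 0 < x' 1 := hx1.trans hlt
  have hyy : (x' 1 + 3) / (4 * x' 1) * x' 0 = y := dilation_sinkShear hx'1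
  have h0 : x' 0 = y * (4 * x' 1) / (x' 1 + 3) := sinkShear_zero _ _
  have hx'0 : 0 < x' 0 := by rw [h0]; positivity
  have hle' : x' 0 < x' 1 := by
    rw [h0, div_lt_iff₀ (by positivity)]
    nlinarith
  have habs : |x 0| ≤ x 1 := by rw [abs_of_pos hx0]; exact hle.le
  have habs' : |x' 0| ≤ x' 1 := by rw [abs_of_pos hx'0]; exact hle'.le
  have hm : maxNorm x = x 1 := maxNorm_eq_of_top habs
  have hm' : maxNorm x' = x' 1 := maxNorm_eq_of_top habs'
  have hu : mapU1 x 0 = y := by rw [mapU1_apply, hm]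
  have hu' : mapU1 x' 0 = y := by rw [mapU1_apply, hm', hyy]
  have hsink : sinkHeight x = 1 - (1 - x 1) / 4 * (7 - 8 * y) := by
    rw [sinkHeight, hu, hm, abs_of_pos hy0, max_eq_left (by linarith)]
  have hsink' : sinkHeight x' = sinkHeight x + Real.pi / α := by
    rw [hsink, sinkHeight, hu', hm', abs_of_pos hy0, max_eq_left (by linarith), hs]
    field_simp
    ring
  refine ⟨⟨by linarith, by linarith, hx'1, h1⟩, hlt, ?_⟩
  rw [leakMap_eq hx'1.le (by rw [hm']; exact hx'1), leakMap_eq hx1.le (by rw [hm]; exact hx1),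
    radius_top habs' (by rw [hm']; exact hx'1), radius_top habs (by rw [hm]; exact hx1),
    angle_top habs' (by rw [hm']; exact hx'1), angle_top habs (by rw [hm]; exact hx1), hu, hu',
    pinch_of_ge (by rw [hsink', hsink]; exact hz'.le), pinch_of_le (by rw [hsink]; exact hz.le),
    hsink']
  have e : α * (2 * (sinkHeight x + Real.pi / α) - 1) =
      α * (2 * sinkHeight x - 1) + 2 * Real.pi := by field_simp; ring
  simp only [mapU4, Matrix.cons_val_zero, Matrix.cons_val_one]
  rw [e, Real.cos_add_two_pi, Real.sin_add_two_pi]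

/-- The points to which `leakMap_sinkShear` applies contain a nonempty open set. -/
theorem exists_open_overlap {α : ℝ} (hα : 4 * Real.pi / 5 < α) (hα' : α < Real.pi) :
    ∃ U : Set Plane, IsOpen U ∧ U.Nonempty ∧ ∀ x ∈ U, 0 < x 0 ∧ 0 < x 1 ∧ x 0 < x 1 ∧ x 1 < 1 ∧
      (x 1 + 3) / (4 * x 1) * x 0 < 3 / 4 ∧
      1 - (1 - x 1) / 4 * (7 - 8 * ((x 1 + 3) / (4 * x 1) * x 0)) < -(1 / 4) ∧
      sinkShear (4 * Real.pi / α) x 1 < 1 ∧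
      3 / 4 < 1 - (1 - x 1) / 4 * (7 - 8 * ((x 1 + 3) / (4 * x 1) * x 0)) + Real.pi / α := by
  have hpi := Real.pi_pos
  have hα0 : 0 < α := by linarith
  have hq1 : 1 < Real.pi / α := by rw [lt_div_iff₀ hα0]; linarith
  have hq2 : Real.pi / α < 5 / 4 := by rw [div_lt_iff₀ hα0]; linarith
  set q := Real.pi / α with hq
  have hc : 4 * Real.pi / α = 4 * q := by rw [hq]; ring
  -- On the vertical axis the conditions say that the height `s` lies strictly between
  -- `(6 - 4 q) / 7` and `2 / 7`.
  set s : ℝ := (2 - q) * (2 / 7) with hs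
  have hs0 : 0 < s := by rw [hs]; nlinarith
  set p : Plane := !₂[0, s] with hp
  have p0 : p 0 = 0 := rfl
  have p1 : p 1 = s := rfl
  have c0 : ContinuousAt (fun x : Plane => x 0) p := by fun_prop
  have c1 : ContinuousAt (fun x : Plane => x 1) p := by fun_prop
  have cy : ContinuousAt (fun x : Plane => (x 1 + 3) / (4 * x 1) * x 0) p :=
    ((c1.add continuousAt_const).div (continuousAt_const.mul c1)
      (show 4 * p 1 ≠ 0 by rw [p1]; positivity)).mul c0
  have yp : (p 1 + 3) / (4 * p 1) * p 0 = 0 := by rw [p0, mul_zero]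
  have cz : ContinuousAt (fun x : Plane =>
      1 - (1 - x 1) / 4 * (7 - 8 * ((x 1 + 3) / (4 * x 1) * x 0))) p :=
    continuousAt_const.sub (((continuousAt_const.sub c1).div_const 4).mul
      (continuousAt_const.sub (continuousAt_const.mul cy)))
  have cs : ContinuousAt (fun x : Plane => sinkShear (4 * Real.pi / α) x 1) p :=
    c1.add (continuousAt_const.div (continuousAt_const.sub (continuousAt_const.mul cy))
      (show 7 - 8 * ((p 1 + 3) / (4 * p 1) * p 0) ≠ 0 by rw [yp]; norm_num))
  have b1 : p 1 < 1 := by rw [p1, hs]; linarith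
  have yq : (p 1 + 3) / (4 * p 1) * p 0 < 3 / 4 := by rw [yp]; norm_num
  have bz : 1 - (1 - p 1) / 4 * (7 - 8 * ((p 1 + 3) / (4 * p 1) * p 0)) < -(1 / 4) := by
    rw [yp, p1, hs]; linarith
  have bs : sinkShear (4 * Real.pi / α) p 1 < 1 := by
    rw [sinkShear_one, yp, p1, hc, hs]; linarith
  have bq : 3 / 4 < 1 - (1 - p 1) / 4 * (7 - 8 * ((p 1 + 3) / (4 * p 1) * p 0)) + q := by
    rw [yp, p1, hs]; linarith
  have hev := (c1.eventually_const_lt hs0).and <|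
    (c0.eventually_lt c1 hs0).and <| (c1.eventually_lt_const b1).and <|
    (cy.eventually_lt_const yq).and <| (cz.eventually_lt_const bz).and <|
    (cs.eventually_lt_const bs).and <| (cz.add_const q).eventually_const_lt bq
  obtain ⟨r, hr, hball⟩ := Metric.eventually_nhds_iff_ball.1 hev
  refine ⟨Metric.ball p r ∩ {x | 0 < x 0}, Metric.isOpen_ball.inter
    (isOpen_lt continuous_const (by fun_prop)), ⟨!₂[r / 2, s], ?_, ?_⟩, fun x hx => ?_⟩
  · rw [Metric.mem_ball, (isometry_horizontal s).dist_eq, Real.dist_eq, sub_zero,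
      abs_of_pos (by positivity)]
    linarith
  · exact half_pos hr
  · obtain ⟨h1, h2, h3, h4, h5, h6, h7⟩ := hball x hx.1
    exact ⟨hx.2, h1, h2, h3, h4, h5, h6, h7⟩

theorem not_injectiveAE_leakMap {α : ℝ} (hα : 4 * Real.pi / 5 < α) (hα' : α < Real.pi) :
    ¬ InjectiveAE rect (leakMap α) := by
  rintro ⟨S, -, hnull, hinj⟩
  have hα0 : 0 < α := by linarith [Real.pi_pos]
  obtain ⟨U, hUo, hUn, hU⟩ := exists_open_overlap hα hα'
  set c := 4 * Real.pi / α with hc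
  -- The points of `U` outside `S`, or moved outside `S` by the shear, form a null set.
  have hbad : volume ((rect \ S) ∪ sinkShear (-c) '' ((rect \ S) ∩ sinkShear c '' U)) = 0 := by
    rw [measure_union_null_iff]
    refine ⟨hnull, ?_⟩
    -- The shear by `-c` is differentiable, so it maps null sets to null sets.
    refine addHaar_image_eq_zero_of_differentiableOn_of_addHaar_eq_zero volume ?_
      (measure_mono_null Set.inter_subset_left hnull)
    rintro _ ⟨-, x, hx, rfl⟩
    obtain ⟨h0, h1, h2, h3, h4, h5, h6, h7⟩ := hU x hx
    obtain ⟨hmem, hlt, -⟩ := leakMap_sinkShear hα0 h0 h1 h2 h3 h4 h5 h6 h7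
    refine (differentiableAt_sinkShear hmem.2.2.1 ?_ ?_).differentiableWithinAt
    · rw [dilation_sinkShear hmem.2.2.1]; exact h4
    · rw [sinkShear_neg_sinkShear hmem.2.2.1 h1]; exact h1
  obtain ⟨x, hxU, hx⟩ : ∃ x ∈ U,
      x ∉ (rect \ S) ∪ sinkShear (-c) '' ((rect \ S) ∩ sinkShear c '' U) := by
    by_contra! h
    exact (hUo.measure_pos volume hUn).ne' (measure_mono_null h hbad)
  obtain ⟨h0, h1, h2, h3, h4, h5, h6, h7⟩ := hU x hxU
  obtain ⟨hmem, hlt, heq⟩ := leakMap_sinkShear hα0 h0 h1 h2 h3 h4 h5 h6 h7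
  have hxS : x ∈ S := by
    by_contra h
    exact hx (Or.inl ⟨⟨by linarith, by linarith, h1, h3⟩, h⟩)
  have hxS' : sinkShear c x ∈ S := by
    by_contra h
    exact hx (Or.inr ⟨sinkShear c x, ⟨⟨hmem, h⟩, x, hxU, rfl⟩,
      sinkShear_neg_sinkShear hmem.2.2.1 h1⟩)
  have := hinj hxS' hxS heq
  rw [← hc, this] at hlt
  exact lt_irrefl _ hlt

end

theorem mainTheorem5 (α : ℝ) (hα₁ : 4 * Real.pi / 5 < α) (hα₂ : α < Real.pi) :
    (∀ p : ENNReal, 1 ≤ p → p < 2 →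
      leakMap α ∈ ClassA rect p ∧ leakMap α ∉ ClassABar rect p) ∧
    (∃ Du : Plane → Matrix (Fin 2) (Fin 2) ℝ, IsWeakGradient rect (leakMap α) Du ∧
      ∀ᵐ x ∂(volume.restrict rect), 0 < (Du x).det) ∧
    (∃ u₀ : OpenPartialHomeomorph Plane Plane,
      closure rect ⊆ u₀.source ∧
      ContDiffOn ℝ ∞ u₀ u₀.source ∧ ContDiffOn ℝ ∞ u₀.symm u₀.target ∧
      IsTrace rect (leakMap α) u₀) ∧
    IsAIB rect (leakMap α) ∧
    ¬ InjectiveAE rect (leakMap α) := by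
  have hα : 0 < α := by linarith [Real.pi_pos]
  exact ⟨fun p hp hp2 => ⟨leakMap_mem_classA hα hp hp2, leakMap_notMem_classABar hα₁ hα₂ hp⟩,
    ⟨leakGradient α, isWeakGradient_leakMap hα, (ae_leakMap α hα).mono fun x hx => hx.2.1⟩,
    ⟨bendHomeomorph hα.ne', closure_rect_subset_source hα hα₂, (contDiff_bendMap α).contDiffOn,
      contDiffOn_bendHomeomorph_symm hα.ne', isTrace_bendMap hα⟩,
    isAIB_leakMap hα hα₂, not_injectiveAE_leakMap hα₁ hα₂⟩
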